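/- Let $N\ge 3$ be an integer, $0\le\alpha<N$, $\beta>\alpha-N$, $p>0$, $q>0$, and let $K_{\alpha,\beta}(x)=|x|^{-\alpha}\log^{\beta}(1+|x|)$ on $\mathbb R^N$. For $\lambda>0$ consider $$\Delta^2u-\lambda\Delta u\ \ge\ (K_{\alpha,\beta}*u^p)\,u^q\quad\text{in }\mathbb R^N,\qquad (P^+)$$ where $(K_{\alpha,\beta}*u^p)(x)=\int_{\mathbb R^N}K_{\alpha,\beta}(x-y)\,u(y)^p\,dy$. A non-negative solution of $(P^+)$ is a function $u\in C^4(\mathbb R^N)$ with $u(x)\ge 0$ and $(K_{\alpha,\beta}*u^p)(x)<\infty$ for all $x\in\mathbb R^N$ that satisfies $(P^+)$ pointwise in $\mathbb R^N$. Assume that one of the following conditions holds: (i) $p>\frac{N-\alpha}{N-2}$, $q>\frac{N-\alpha}{N-2}$ and $p+q>\frac{2N-\alpha}{N-2}$ (and $\beta>\alpha-N$); (ii) $p=\frac{N-\alpha}{N-2}$, $q>\frac{N}{N-2}$ and $\beta<-1$; (iii) $p>\frac{N}{N-2}$, $q=\frac{N-\alpha}{N-2}$ and $\beta<-1$; (iv)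 $p>\frac{N-\alpha}{N-2}$, $q>\frac{N-\alpha}{N-2}$, $p+q=\frac{2N-\alpha}{N-2}$ and $\beta<-1$; (v) $p=\frac{N-\alpha}{N-2}$, $q=\frac{N}{N-2}$ and $\beta<-2$; (vi) $p=\frac{N}{N-2}$, $q=\frac{N-\alpha}{N-2}$ and $\beta<-2$. Then there exists $\lambda>0$ such that $(P^+)$ has a non-negative solution $u$ that is not identically zero; in fact $u$ can be taken positive everywhere in $\mathbb R^N$ and of the form $$u=C\,\Phi*\big(w^{-\gamma}\log^{\tau}w\big),\qquad w(x)=(A+|x|^2)^{1/2},$$ for some constants $C>0$, $A>e$, $2<\gamma\le N$ and $-1<\tau<1$, where $\Phi(x)=\frac{1}{(N-2)\sigma_N}|x|^{-(N-2)}$ is the fundamental solution of $-\Delta$ and $\sigma_N$ is the area of the unit sphere of $\mathbb R^N$. -/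

import Mathlib

open MeasureTheory
open scoped Laplacian

noncomputable section

/-- The kernel `K_{α,β}(x) = |x|^{-α} log^β (1 + |x|)` on `ℝ^N`. -/
def kernelK (N : ℕ) (α β : ℝ) (x : EuclideanSpace ℝ (Fin N)) : ℝ :=
  ‖x‖ ^ (-α) * (Real.log (1 + ‖x‖)) ^ β

/-- The convolution `(K_{α,β} * u^p)(x) = ∫ K_{α,β}(x - y) u(y)^p dy`. -/
def convK (N : ℕ) (α β p : ℝ) (u : EuclideanSpace ℝ (Fin N) → ℝ)
    (x : EuclideanSpace ℝ (Fin N)) : ℝ :=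
  ∫ y, kernelK N α β (x - y) * u y ^ p

/-- Classical non-negative solutions of `Δ² u - λ Δ u ≥ (K_{α,β} * u^p) u^q` in `ℝ^N`: `u` is
`C⁴` and non-negative, the convolution is finite at every point (the integrand is non-negative and
measurable, so this is integrability), and the inequality holds pointwise. -/
structure IsNonnegSolution (N : ℕ) (α β p q lam : ℝ) (u : EuclideanSpace ℝ (Fin N) → ℝ) :
    Prop where
  contDiff : ContDiff ℝ 4 u
  nonneg : ∀ x, 0 ≤ u x
  conv_finite : ∀ x, Integrable (fun y => kernelK N α β (x - y) * u y ^ p)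
  inequality : ∀ x, convK N α β p u x * u x ^ q ≤ Δ (Δ u) x - lam * Δ u x

/-- The `(N-1)`-dimensional area `σ_N` of the unit sphere of `ℝ^N`. -/
def sphereArea (N : ℕ) : ℝ :=
  ((volume : Measure (EuclideanSpace ℝ (Fin N))).toSphere Set.univ).toReal

/-- The fundamental solution `Φ(x) = |x|^{-(N-2)} / ((N-2) σ_N)` of `-Δ` on `ℝ^N`, `N ≥ 3`. -/
def fundSol (N : ℕ) (x : EuclideanSpace ℝ (Fin N)) : ℝ :=
  1 / (((N : ℝ) - 2) * sphereArea N) * ‖x‖ ^ (-((N : ℝ) - 2))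

/-- The weight `w(x) = (A + |x|²)^{1/2}`. -/
def weightW (N : ℕ) (A : ℝ) (x : EuclideanSpace ℝ (Fin N)) : ℝ :=
  (A + ‖x‖ ^ 2) ^ (1 / 2 : ℝ)

/-- The potential `Φ * (w^{-γ} log^τ w)`. -/
def logPotential (N : ℕ) (A γ τ : ℝ) (x : EuclideanSpace ℝ (Fin N)) : ℝ :=
  ∫ y, fundSol N (x - y) * (weightW N A y ^ (-γ) * (Real.log (weightW N A y)) ^ τ)

end

/-! Fix `A = e²`, so that `w ≥ e` and `log w ≥ 1`, and take `v = w^{-N} log^{T-1} w` with a small `0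
< T < 1`; the solution is `u = C Φ * v`, that is, `γ = N` and `τ = T - 1`.

Since `-Δ(Φ * v) = v` (`laplacian_logPotential`), the left side of the inequality is `C(-Δv + λv)`.
All derivatives of `v` are `O(v)` (`norm_iteratedFDeriv_logProfile_weightW_le`), so for `λ` large it
is at least `C v`. The exponent `N` is critical for the potential: because `T - 1 > -1`, the mass of
`v` in a ball grows like `log^T`, and `Φ * v` is `O(w^{-(N-2)} log^T w)`.

The right side is handled by upper bounds alone. Inserting this bound, `K * u^p` is controlled by `K
* (w^{-a} log^b w)` with `a = (N-2)p`, `b = Tp`, whose decay `w^{-c} log^d w` is found in four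
regimes of `a` by `kernelK_convolution_decay`. It remains that `w^{-c-(N-2)q} log^{d+Tq} w` be
`O(v)`. If `c + (N-2)q > N` the logarithms do not matter; if there is equality, one needs `d + Tq ≤
T - 1`, and this is where `β < -1` or `β < -2` leaves room for a small `T`. Finally `p + q > 1`, so
the right side is of higher degree in `C` than the left and a suitable `C` absorbs all constants
(`exists_solution_of_convolution_decay`).

Two facts are proved from first principles: a convolution estimate for functions that are doubling
in the norm (`lintegral_sub_mul_le`), and the identity `∫ Φ Δg = -g(0)` for decaying `g`
(`integral_fundSol_mul_laplacian`), obtained by regularising `Φ`. -/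

/-- The profile `t^{-a} log^b t`. -/
noncomputable def logProfile (a b t : ℝ) : ℝ := t ^ (-a) * (Real.log t) ^ b

/-! ### Calculus of the profiles `t^{-a} log^b t` on `t ≥ e`. -/

section Profile

variable {a b c d s t : ℝ}

lemma one_le_log_of_exp_one_le (ht : Real.exp 1 ≤ t) : 1 ≤ Real.log t := by
  rwa [Real.le_log_iff_exp_le ((Real.exp_pos 1).trans_le ht)]

lemma pos_of_exp_one_le (ht : Real.exp 1 ≤ t) : 0 < t := (Real.exp_pos 1).trans_le ht

lemma one_le_of_exp_one_le (ht : Real.exp 1 ≤ t) : 1 ≤ t :=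
  (Real.one_le_exp zero_le_one).trans ht

lemma logProfile_pos (ht : Real.exp 1 ≤ t) : 0 < logProfile a b t :=
  mul_pos (Real.rpow_pos_of_pos (pos_of_exp_one_le ht) _)
    (Real.rpow_pos_of_pos (zero_lt_one.trans_le (one_le_log_of_exp_one_le ht)) _)

lemma logProfile_mul (ht : Real.exp 1 ≤ t) :
    logProfile a b t * logProfile c d t = logProfile (a + c) (b + d) t := by
  have h1 := pos_of_exp_one_le ht
  have h2 := zero_lt_one.trans_le (one_le_log_of_exp_one_le ht)
  unfold logProfile
  rw [neg_add, Real.rpow_add h1, Real.rpow_add h2]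
  ring

lemma logProfile_rpow (ht : Real.exp 1 ≤ t) (p : ℝ) :
    logProfile a b t ^ p = logProfile (a * p) (b * p) t := by
  have h1 := pos_of_exp_one_le ht
  have h2 := zero_lt_one.trans_le (one_le_log_of_exp_one_le ht)
  unfold logProfile
  rw [Real.mul_rpow (by positivity) (by positivity), ← Real.rpow_mul h1.le, ← Real.rpow_mul h2.le,
    neg_mul]

lemma logProfile_neg (ht : Real.exp 1 ≤ t) :
    logProfile (-a) (-b) t = (logProfile a b t)⁻¹ := by
  have := logProfile_rpow (a := a) (b := b) ht (-1)
  rw [Real.rpow_neg_one] at this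
  simp [this]

@[simp] lemma logProfile_zero_zero : logProfile 0 0 t = 1 := by simp [logProfile]

lemma logProfile_le_logProfile_of_log_le (ht : Real.exp 1 ≤ t) (h : b ≤ d) :
    logProfile a b t ≤ logProfile a d t :=
  mul_le_mul_of_nonneg_left (Real.rpow_le_rpow_of_exponent_le (one_le_log_of_exp_one_le ht) h)
    (Real.rpow_nonneg (pos_of_exp_one_le ht).le _)

/-- A Potter-type bound. For `b > 0` the profile may increase near `e`, but the growth of the
logarithm from `s` to `t` costs at most a multiple of `(t/s)^ε`; with `ε = a/b` its `b`-th power is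
cancelled exactly by the decay of `t^{-a}`. -/
lemma logProfile_almost_antitone (ha : 0 < a) (b : ℝ) :
    ∃ C > 0, ∀ s t, Real.exp 1 ≤ s → s ≤ t → logProfile a b t ≤ C * logProfile a b s := by
  rcases le_or_gt b 0 with hb | hb
  · refine ⟨1, one_pos, fun s t hs hst => ?_⟩
    have hs0 := pos_of_exp_one_le hs
    have hl := one_le_log_of_exp_one_le hs
    rw [one_mul]
    exact mul_le_mul (Real.rpow_le_rpow_of_nonpos hs0 hst (by linarith))
      (Real.rpow_le_rpow_of_nonpos (by linarith) (Real.log_le_log hs0 hst) hb)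
      (Real.rpow_nonneg (hl.trans (Real.log_le_log hs0 hst) |>.trans' zero_le_one) _)
      (Real.rpow_nonneg hs0.le _)
  · set ε := a / b with hε
    have hε0 : 0 < ε := div_pos ha hb
    refine ⟨(1 + 1 / ε) ^ b, by positivity, fun s t hs hst => ?_⟩
    have hs0 := pos_of_exp_one_le hs
    have ht0 := hs0.trans_le hst
    have hl := one_le_log_of_exp_one_le hs
    have hlt := one_le_log_of_exp_one_le (hs.trans hst)
    have hr : 1 ≤ t / s := (one_le_div hs0).2 hst
    have h1 : Real.log t ≤ Real.log s * ((1 + 1 / ε) * (t / s) ^ ε) := by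
      have e1 : Real.log t = Real.log s + Real.log (t / s) := by
        rw [Real.log_div ht0.ne' hs0.ne']; ring
      have e2 : Real.log (t / s) ≤ (t / s) ^ ε / ε := Real.log_le_rpow_div (by positivity) hε0
      have e3 : 1 ≤ (t / s) ^ ε := Real.one_le_rpow hr hε0.le
      have e4 : 0 ≤ (t / s) ^ ε / ε := by positivity
      calc Real.log t ≤ Real.log s * 1 + Real.log s * ((t / s) ^ ε / ε) := by nlinarith
        _ ≤ Real.log s * (t / s) ^ ε + Real.log s * ((t / s) ^ ε / ε) := by gcongr
        _ = _ := by ring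
    have h2 : Real.log t ^ b ≤ Real.log s ^ b * ((1 + 1 / ε) ^ b * (t / s) ^ a) := by
      calc Real.log t ^ b ≤ (Real.log s * ((1 + 1 / ε) * (t / s) ^ ε)) ^ b :=
            Real.rpow_le_rpow (by linarith) h1 hb.le
        _ = _ := by
            rw [Real.mul_rpow (by linarith) (by positivity),
              Real.mul_rpow (by positivity) (by positivity), ← Real.rpow_mul (by positivity), hε,
              div_mul_cancel₀ _ hb.ne']
    calc logProfile a b t ≤ t ^ (-a) * (Real.log s ^ b * ((1 + 1 / ε) ^ b * (t / s) ^ a)) :=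
          mul_le_mul_of_nonneg_left h2 (by positivity)
      _ = (1 + 1 / ε) ^ b * logProfile a b s := by
          unfold logProfile
          rw [Real.div_rpow ht0.le hs0.le, Real.rpow_neg ht0.le, Real.rpow_neg hs0.le]
          field_simp

lemma logProfile_almost_monotone (ha : a < 0) (b : ℝ) :
    ∃ C > 0, ∀ s t, Real.exp 1 ≤ s → s ≤ t → logProfile a b s ≤ C * logProfile a b t := by
  obtain ⟨C, hC, h⟩ := logProfile_almost_antitone (neg_pos.2 ha) (-b)
  refine ⟨C, hC, fun s t hs hst => ?_⟩
  have h1 := h s t hs hst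
  rw [logProfile_neg (hs.trans hst), logProfile_neg hs] at h1
  have p1 := logProfile_pos (a := a) (b := b) hs
  have p2 := logProfile_pos (a := a) (b := b) (hs.trans hst)
  rw [inv_eq_one_div, ← div_eq_mul_inv, div_le_div_iff₀ p2 p1] at h1
  linarith

lemma logProfile_le_of_lt (h : c < a) (b d : ℝ) :
    ∃ C > 0, ∀ t, Real.exp 1 ≤ t → logProfile a b t ≤ C * logProfile c d t := by
  obtain ⟨C, hC, hh⟩ := logProfile_almost_antitone (sub_pos.2 h) (b - d)
  refine ⟨C * logProfile (a - c) (b - d) (Real.exp 1), mul_pos hC (logProfile_pos le_rfl),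
    fun t ht => ?_⟩
  have := hh _ t le_rfl ht
  have e : logProfile a b t = logProfile (a - c) (b - d) t * logProfile c d t := by
    rw [logProfile_mul ht]; congr 1 <;> ring
  rw [e]
  exact mul_le_mul_of_nonneg_right this (logProfile_pos ht).le

lemma rpow_le_rpow_of_comparable {κ x y : ℝ} (c : ℝ) (hκ : 1 ≤ κ) (hx : 0 < x) (hy : 0 < y)
    (hxy : x ≤ κ * y) (hyx : y ≤ κ * x) : x ^ c ≤ κ ^ |c| * y ^ c := by
  rcases le_total 0 c with hc | hc
  · rw [abs_of_nonneg hc, ← Real.mul_rpow (by linarith) hy.le]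
    exact Real.rpow_le_rpow hx.le hxy hc
  · rw [abs_of_nonpos hc]
    have h1 : y ^ (-c) ≤ κ ^ (-c) * x ^ (-c) := by
      rw [← Real.mul_rpow (by linarith) hx.le]
      exact Real.rpow_le_rpow hy.le hyx (by linarith)
    have h2 : x ^ (-c) * x ^ c = 1 := by rw [← Real.rpow_add hx]; simp
    have h3 : y ^ (-c) * y ^ c = 1 := by rw [← Real.rpow_add hy]; simp
    calc x ^ c = (y ^ (-c) * y ^ c) * x ^ c := by rw [h3, one_mul]
      _ ≤ (κ ^ (-c) * x ^ (-c) * y ^ c) * x ^ c := by gcongr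
      _ = κ ^ (-c) * y ^ c * (x ^ (-c) * x ^ c) := by ring
      _ = _ := by rw [h2, mul_one]

/-- Since `log t ≥ 1`, the additive error `log κ` in the logarithm becomes a factor `1 + log κ`. -/
lemma logProfile_comparable {κ : ℝ} (hκ : 1 ≤ κ) (a b : ℝ) :
    ∃ D ≥ 1, ∀ s t, Real.exp 1 ≤ s → Real.exp 1 ≤ t → s ≤ κ * t → t ≤ κ * s →
      logProfile a b s ≤ D * logProfile a b t := by
  have hlκ : 0 ≤ Real.log κ := Real.log_nonneg hκ
  refine ⟨κ ^ |a| * (1 + Real.log κ) ^ |b|, one_le_mul_of_one_le_of_one_le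
    (Real.one_le_rpow hκ (abs_nonneg _)) (Real.one_le_rpow (by linarith) (abs_nonneg _)),
    fun s t hs ht hst hts => ?_⟩
  have key : ∀ s t, Real.exp 1 ≤ s → Real.exp 1 ≤ t → s ≤ κ * t →
      Real.log s ≤ (1 + Real.log κ) * Real.log t := fun s t hs ht hst => by
    have := Real.log_le_log (pos_of_exp_one_le hs) hst
    rw [Real.log_mul (by linarith) (pos_of_exp_one_le ht).ne'] at this
    nlinarith [one_le_log_of_exp_one_le ht]
  have h1 := rpow_le_rpow_of_comparable (-a) hκ (pos_of_exp_one_le hs) (pos_of_exp_one_le ht) hst hts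
  have h2 := rpow_le_rpow_of_comparable b (by linarith : 1 ≤ 1 + Real.log κ)
    (zero_lt_one.trans_le (one_le_log_of_exp_one_le hs))
    (zero_lt_one.trans_le (one_le_log_of_exp_one_le ht)) (key s t hs ht hst) (key t s ht hs hts)
  have h3 := one_le_log_of_exp_one_le hs
  have h4 := pos_of_exp_one_le ht
  rw [abs_neg] at h1
  calc logProfile a b s ≤ (κ ^ |a| * t ^ (-a)) * ((1 + Real.log κ) ^ |b| * Real.log t ^ b) :=
        mul_le_mul h1 h2 (by positivity) (by positivity)
    _ = _ := by unfold logProfile; ring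

end Profile

/-! ### The weight `w` and its comparison at nearby points. -/

section Weight

variable {N : ℕ} {A : ℝ}

/-- The radial profile of `weightW`. -/
noncomputable def radialWeight (A r : ℝ) : ℝ := (A + r ^ 2) ^ (1 / 2 : ℝ)

lemma weightW_eq_radialWeight (x : EuclideanSpace ℝ (Fin N)) :
    weightW N A x = radialWeight A ‖x‖ := rfl

lemma radialWeight_eq_sqrt (r : ℝ) : radialWeight A r = √(A + r ^ 2) := by
  rw [radialWeight, Real.sqrt_eq_rpow]

lemma radialWeight_sq (hA : Real.exp 2 ≤ A) (r : ℝ) : radialWeight A r ^ 2 = A + r ^ 2 := by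
  have := Real.exp_pos 2
  rw [radialWeight_eq_sqrt, Real.sq_sqrt (by nlinarith [sq_nonneg r])]

lemma exp_one_le_radialWeight (hA : Real.exp 2 ≤ A) (r : ℝ) :
    Real.exp 1 ≤ radialWeight A r := by
  rw [radialWeight_eq_sqrt]
  apply Real.le_sqrt_of_sq_le
  rw [← Real.exp_nat_mul]
  norm_num
  nlinarith [sq_nonneg r]

lemma radialWeight_pos (hA : Real.exp 2 ≤ A) (r : ℝ) : 0 < radialWeight A r :=
  pos_of_exp_one_le (exp_one_le_radialWeight hA r)

lemma le_radialWeight (hA : Real.exp 2 ≤ A) {r : ℝ} : r ≤ radialWeight A r := by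
  rw [radialWeight_eq_sqrt]
  have := Real.exp_pos 2
  exact Real.le_sqrt_of_sq_le (by linarith)

lemma radialWeight_mono {r s : ℝ} (hr : 0 ≤ r) (h : r ≤ s) :
    radialWeight A r ≤ radialWeight A s := by
  rw [radialWeight_eq_sqrt, radialWeight_eq_sqrt]
  gcongr

lemma radialWeight_le_mul (hA : Real.exp 2 ≤ A) {r s κ : ℝ} (hr : 0 ≤ r) (hκ : 1 ≤ κ)
    (h : r ≤ κ * s) : radialWeight A r ≤ κ * radialWeight A s := by
  have h0 := radialWeight_pos hA s
  have := Real.exp_pos 2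
  refine (sq_le_sq₀ (radialWeight_pos hA r).le (by positivity)).1 ?_
  rw [mul_pow, radialWeight_sq hA, radialWeight_sq hA]
  nlinarith [pow_le_pow_left₀ hr h 2, one_le_pow₀ hκ (n := 2)]

lemma radialWeight_add_le (hA : Real.exp 2 ≤ A) {r s : ℝ} (hs : 0 ≤ s) :
    radialWeight A (r + s) ≤ (1 + s) * radialWeight A r := by
  have h0 := radialWeight_pos hA r
  have h1 : r ≤ radialWeight A r := le_radialWeight hA
  have h2 := one_le_of_exp_one_le (exp_one_le_radialWeight hA r)
  refine (sq_le_sq₀ (radialWeight_pos hA _).le (by positivity)).1 ?_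
  have h4 : r ≤ radialWeight A r ^ 2 := h1.trans (by nlinarith)
  have h5 : 1 ≤ radialWeight A r ^ 2 := one_le_pow₀ h2
  have h6 := radialWeight_sq hA r
  rw [mul_pow, radialWeight_sq hA (r + s)]
  nlinarith [mul_le_mul_of_nonneg_left h4 hs, mul_le_mul_of_nonneg_left h5 (sq_nonneg s)]

lemma weightW_le_of_norm_sub_le (hA : Real.exp 2 ≤ A) {x y : EuclideanSpace ℝ (Fin N)} {s : ℝ}
    (h : ‖x - y‖ ≤ s) : weightW N A x ≤ (1 + s) * weightW N A y := by
  have hs : 0 ≤ s := (norm_nonneg _).trans h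
  refine le_trans (radialWeight_mono (norm_nonneg _) ?_)
    (radialWeight_add_le hA hs)
  calc ‖x‖ = ‖y + (x - y)‖ := by simp
    _ ≤ ‖y‖ + s := (norm_add_le _ _).trans (by linarith)

lemma exp_one_le_weightW (hA : Real.exp 2 ≤ A) (x : EuclideanSpace ℝ (Fin N)) :
    Real.exp 1 ≤ weightW N A x := exp_one_le_radialWeight hA _

lemma continuous_weightW : Continuous (weightW N A) := by
  unfold weightW
  exact (by fun_prop : Continuous fun x : EuclideanSpace ℝ (Fin N) => A + ‖x‖ ^ 2).rpow_const
    fun x => Or.inr (by norm_num)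

lemma continuous_logProfile_weightW (hA : Real.exp 2 ≤ A) (a b : ℝ) :
    Continuous fun x => logProfile a b (weightW N A x) := by
  have hc := continuous_weightW (N := N) (A := A)
  have h1 : ∀ x, weightW N A x ≠ 0 := fun x => (pos_of_exp_one_le (exp_one_le_weightW hA x)).ne'
  have h2 : ∀ x, Real.log (weightW N A x) ≠ 0 := fun x =>
    (zero_lt_one.trans_le (one_le_log_of_exp_one_le (exp_one_le_weightW hA x))).ne'
  exact (hc.rpow_const fun x => Or.inl (h1 x)).mul
    ((hc.log h1).rpow_const fun x => Or.inl (h2 x))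

end Weight

/-! ### Integrals of profiles over balls and exteriors of balls. -/

section Radial

open Set

/-- Polar coordinates. The free majorant `g` allows the radial density to be replaced by one with an
explicit primitive. -/
lemma setLIntegral_radial_le {N : ℕ} (hN : 2 ≤ N) {F g : ℝ → ℝ} {S T : Set ℝ}
    (hS : MeasurableSet S) (hT : MeasurableSet T) (hST : S ∩ Ioi 0 ⊆ T) (hF : Measurable F)
    (hF0 : ∀ r ∈ S, 0 ≤ F r) (hg : IntegrableOn g T) (hg0 : ∀ r ∈ T, 0 ≤ g r)
    (hle : ∀ r ∈ S, 0 < r → r ^ (N - 1) * F r ≤ g r) :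
    ∫⁻ y in {y : EuclideanSpace ℝ (Fin N) | ‖y‖ ∈ S}, ENNReal.ofReal (F ‖y‖) ≤
      ENNReal.ofReal (N * (volume : Measure (EuclideanSpace ℝ (Fin N))).real
        (Metric.ball 0 1) * ∫ r in T, g r) := by
  have : Nontrivial (EuclideanSpace ℝ (Fin N)) :=
    Module.nontrivial_of_finrank_pos (R := ℝ) (by simp; omega)
  have hSm : MeasurableSet {y : EuclideanSpace ℝ (Fin N) | ‖y‖ ∈ S} := measurable_norm hS
  set f : ℝ → ℝ := indicator S F with hf
  have hf0 : ∀ r, 0 ≤ f r := fun r => indicator_nonneg hF0 r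
  have hb : ∀ r, 0 < r → r ^ (N - 1) * f r ≤ indicator T g r := fun r hr => by
    by_cases h : r ∈ S
    · rw [hf, indicator_of_mem h, indicator_of_mem (hST ⟨h, hr⟩)]
      exact hle r h hr
    · rw [hf, indicator_of_notMem h, mul_zero]
      exact indicator_nonneg hg0 r
  have hgi : Integrable (indicator T g) := (integrable_indicator_iff hT).2 hg
  have hi : IntegrableOn (fun r : ℝ => r ^ (N - 1) • f r) (Ioi 0) := by
    refine hgi.integrableOn.mono' ((measurable_id.pow_const _).mul
      (hF.indicator hS)).aestronglyMeasurable ?_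
    filter_upwards [ae_restrict_mem measurableSet_Ioi] with r hr
    rw [smul_eq_mul, Real.norm_of_nonneg (mul_nonneg (pow_nonneg (le_of_lt hr) _) (hf0 r))]
    exact hb r hr
  have hi2 := integrable_fun_norm_addHaar (f := f)
    (volume : Measure (EuclideanSpace ℝ (Fin N)))
  have he := integral_fun_norm_addHaar (volume : Measure (EuclideanSpace ℝ (Fin N))) f
  simp only [finrank_euclideanSpace, Fintype.card_fin] at hi2 he
  have hi3 := hi2.2 hi
  have e1 : ∫⁻ y in {y : EuclideanSpace ℝ (Fin N) | ‖y‖ ∈ S}, ENNReal.ofReal (F ‖y‖) =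
      ∫⁻ y : EuclideanSpace ℝ (Fin N), ENNReal.ofReal (f ‖y‖) := by
    rw [← lintegral_indicator hSm]
    refine lintegral_congr fun y => ?_
    by_cases h : ‖y‖ ∈ S
    · rw [indicator_of_mem (by exact h), hf, indicator_of_mem h]
    · rw [indicator_of_notMem (by exact h), hf, indicator_of_notMem h, ENNReal.ofReal_zero]
  rw [e1, ← ofReal_integral_eq_lintegral_ofReal hi3 (Filter.Eventually.of_forall fun y => hf0 _),
    he, nsmul_eq_mul, smul_eq_mul, mul_assoc]
  refine ENNReal.ofReal_le_ofReal ?_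
  gcongr
  rw [← integral_indicator hT]
  calc _ ≤ ∫ r in Ioi (0 : ℝ), indicator T g r :=
        setIntegral_mono_on hi hgi.integrableOn measurableSet_Ioi fun r hr => hb r hr
    _ ≤ _ := setIntegral_le_integral hgi (Filter.Eventually.of_forall fun r =>
        indicator_nonneg hg0 r)

variable {N : ℕ} {A : ℝ}

lemma hasDerivAt_radialWeight (hA : Real.exp 2 ≤ A) (r : ℝ) :
    HasDerivAt (radialWeight A) (r / radialWeight A r) r := by
  have h1 : HasDerivAt (fun r : ℝ => A + r ^ 2) (2 * r) r := by
    simpa using ((hasDerivAt_id r).pow 2).const_add A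
  have h2 := h1.sqrt (by nlinarith [Real.exp_pos 2, sq_nonneg r])
  have h3 : radialWeight A = fun r => √(A + r ^ 2) := funext radialWeight_eq_sqrt
  rw [h3]
  convert h2 using 1
  field_simp

lemma continuous_radialWeight : Continuous (radialWeight A) := by
  unfold radialWeight
  exact (by fun_prop : Continuous fun r : ℝ => A + r ^ 2).rpow_const fun x => Or.inr (by norm_num)

lemma continuous_logProfile_radialWeight (hA : Real.exp 2 ≤ A) (a b : ℝ) :
    Continuous fun r => logProfile a b (radialWeight A r) := by
  have h1 : ∀ x, radialWeight A x ≠ 0 := fun x => (radialWeight_pos hA x).ne'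
  have h2 : ∀ x, Real.log (radialWeight A x) ≠ 0 := fun x =>
    (zero_lt_one.trans_le (one_le_log_of_exp_one_le (exp_one_le_radialWeight hA x))).ne'
  exact (continuous_radialWeight.rpow_const fun x => Or.inl (h1 x)).mul
    ((continuous_radialWeight.log h1).rpow_const fun x => Or.inl (h2 x))

lemma hasDerivAt_radialWeight_rpow (hA : Real.exp 2 ≤ A) {m : ℝ} (hm : m ≠ 0) (r : ℝ) :
    HasDerivAt (fun r => radialWeight A r ^ m / m) (r * logProfile (2 - m) 0 (radialWeight A r))
      r := by
  have h0 := radialWeight_pos hA r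
  have h := ((hasDerivAt_radialWeight hA r).rpow_const (p := m) (Or.inl h0.ne')).div_const m
  refine h.congr_deriv (Eq.symm ?_)
  rw [logProfile, Real.rpow_zero, show -(2 - m) = (m - 1) - 1 by ring, Real.rpow_sub_one h0.ne']
  field_simp

lemma hasDerivAt_log_radialWeight_rpow (hA : Real.exp 2 ≤ A) {b : ℝ} (hb : b + 1 ≠ 0) (r : ℝ) :
    HasDerivAt (fun r => Real.log (radialWeight A r) ^ (b + 1) / (b + 1))
      (r * logProfile 2 b (radialWeight A r)) r := by
  have h0 := radialWeight_pos hA r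
  have hl := one_le_log_of_exp_one_le (exp_one_le_radialWeight hA r)
  have h := (((hasDerivAt_radialWeight hA r).log h0.ne').rpow_const (p := b + 1)
    (Or.inl (by linarith))).div_const (b + 1)
  refine h.congr_deriv (Eq.symm ?_)
  rw [logProfile, Real.rpow_neg h0.le, add_sub_cancel_right]
  norm_num
  field_simp

/-- Replacing `r^{N-2}` by `w^{N-2}` leaves the single factor `r` that comes from differentiating
`w²`, so the right side is an exact derivative in the pure power case and in the critical case `a =
N`. -/
lemma pow_mul_logProfile_le (hA : Real.exp 2 ≤ A) (hN : 2 ≤ N) (a b : ℝ) {r : ℝ} (hr : 0 ≤ r) :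
    r ^ (N - 1) * logProfile a b (radialWeight A r) ≤
      r * logProfile (2 - (N - a)) b (radialWeight A r) := by
  have h0 := radialWeight_pos hA r
  have hl := one_le_log_of_exp_one_le (exp_one_le_radialWeight hA r)
  obtain ⟨k, rfl⟩ := Nat.exists_eq_add_of_le' hN
  have h1 : r ^ k ≤ radialWeight A r ^ k := pow_le_pow_left₀ hr (le_radialWeight hA) k
  have e : logProfile (2 - ((k + 2 : ℕ) - a)) b (radialWeight A r) =
      radialWeight A r ^ k * logProfile a b (radialWeight A r) := by
    unfold logProfile
    rw [← mul_assoc, ← Real.rpow_natCast, ← Real.rpow_add h0]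
    congr 2
    push_cast
    ring
  rw [e, show k + 2 - 1 = k + 1 from rfl, pow_succ]
  have := logProfile_pos (a := a) (b := b) (exp_one_le_radialWeight hA r)
  calc r ^ k * r * logProfile a b (radialWeight A r)
      ≤ radialWeight A r ^ k * r * logProfile a b (radialWeight A r) := by gcongr
    _ = _ := by ring

/-- The mass constant of radial integration. -/
noncomputable def radialMass (N : ℕ) : ℝ :=
  N * (volume : Measure (EuclideanSpace ℝ (Fin N))).real (Metric.ball 0 1)

lemma radialMass_nonneg : 0 ≤ radialMass N := by unfold radialMass; positivity

lemma lintegral_logProfile_ball_le (hA : Real.exp 2 ≤ A) (hN : 2 ≤ N) {a b : ℝ} {G : ℝ → ℝ}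
    (hG : ∀ r, HasDerivAt G (r * logProfile (2 - (N - a)) b (radialWeight A r)) r) {R : ℝ}
    (hR : 0 ≤ R) :
    ∫⁻ y in {y : EuclideanSpace ℝ (Fin N) | ‖y‖ ≤ R},
      ENNReal.ofReal (logProfile a b (weightW N A y)) ≤
      ENNReal.ofReal (radialMass N * (G R - G 0)) := by
  have hc : Continuous fun r => r * logProfile (2 - (N - a)) b (radialWeight A r) :=
    continuous_id.mul (continuous_logProfile_radialWeight hA _ _)
  have h := setLIntegral_radial_le hN (F := fun r => logProfile a b (radialWeight A r))
    (g := fun r => r * logProfile (2 - (N - a)) b (radialWeight A r)) (S := Iic R) (T := Ioc 0 R)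
    measurableSet_Iic measurableSet_Ioc (fun r hr => ⟨hr.2, hr.1⟩)
    (continuous_logProfile_radialWeight hA _ _).measurable
    (fun r _ => (logProfile_pos (exp_one_le_radialWeight hA r)).le)
    (hc.integrableOn_Icc.mono_set Ioc_subset_Icc_self)
    (fun r hr => mul_nonneg hr.1.le (logProfile_pos (exp_one_le_radialWeight hA r)).le)
    (fun r _ hr => pow_mul_logProfile_le hA hN a b hr.le)
  rwa [← intervalIntegral.integral_of_le hR, intervalIntegral.integral_eq_sub_of_hasDerivAt
    (fun r _ => hG r) (hc.intervalIntegrable _ _)] at h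

lemma lintegral_logProfile_tail_le (hA : Real.exp 2 ≤ A) (hN : 2 ≤ N) {a b : ℝ} {G : ℝ → ℝ}
    (hG : ∀ r, HasDerivAt G (r * logProfile (2 - (N - a)) b (radialWeight A r)) r)
    (hG0 : Filter.Tendsto G Filter.atTop (nhds 0)) {R : ℝ} (hR : 0 ≤ R) :
    ∫⁻ y in {y : EuclideanSpace ℝ (Fin N) | R ≤ ‖y‖},
      ENNReal.ofReal (logProfile a b (weightW N A y)) ≤
      ENNReal.ofReal (radialMass N * (0 - G R)) := by
  have hp : ∀ r ∈ Ioi R, 0 ≤ r * logProfile (2 - (N - a)) b (radialWeight A r) := fun r hr =>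
    mul_nonneg (hR.trans (le_of_lt hr)) (logProfile_pos (exp_one_le_radialWeight hA r)).le
  have hp' : ∀ r ∈ Ici R, 0 ≤ r * logProfile (2 - (N - a)) b (radialWeight A r) := fun r hr =>
    mul_nonneg (hR.trans hr) (logProfile_pos (exp_one_le_radialWeight hA r)).le
  have hi := integrableOn_Ioi_deriv_of_nonneg' (fun r _ => hG r) hp hG0
  have h := setLIntegral_radial_le hN (F := fun r => logProfile a b (radialWeight A r))
    (g := fun r => r * logProfile (2 - (N - a)) b (radialWeight A r)) (S := Ici R) (T := Ici R)
    measurableSet_Ici measurableSet_Ici (fun r hr => hr.1)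
    (continuous_logProfile_radialWeight hA _ _).measurable
    (fun r _ => (logProfile_pos (exp_one_le_radialWeight hA r)).le)
    ((integrableOn_Ici_iff_integrableOn_Ioi enorm_ne_top).2 hi) hp'
    (fun r _ hr => pow_mul_logProfile_le hA hN a b hr.le)
  rwa [integral_Ici_eq_integral_Ioi, integral_Ioi_of_hasDerivAt_of_nonneg' (fun r _ => hG r) hp hG0]
    at h

lemma tendsto_radialWeight_atTop (hA : Real.exp 2 ≤ A) :
    Filter.Tendsto (radialWeight A) Filter.atTop Filter.atTop :=
  Filter.tendsto_atTop_mono (fun _ => le_radialWeight hA) Filter.tendsto_id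

lemma lintegral_ball_zero_log (hA : Real.exp 2 ≤ A) (hN : 2 ≤ N) {a : ℝ} (ha : a < N) :
    ∃ C > 0, ∀ R, 0 ≤ R → ∫⁻ y in {y : EuclideanSpace ℝ (Fin N) | ‖y‖ ≤ R},
      ENNReal.ofReal (logProfile a 0 (weightW N A y)) ≤
      ENNReal.ofReal (C * logProfile (a - N) 0 (radialWeight A R)) := by
  have hm : 0 < N - a := by linarith
  have hM := radialMass_nonneg (N := N)
  refine ⟨(radialMass N + 1) * (1 / (N - a)), by positivity, fun R hR => ?_⟩
  refine (lintegral_logProfile_ball_le hA hN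
    (hasDerivAt_radialWeight_rpow hA hm.ne') hR).trans (ENNReal.ofReal_le_ofReal ?_)
  have h0 := radialWeight_pos hA 0
  have hR0 := radialWeight_pos hA R
  rw [logProfile, Real.rpow_zero, neg_sub, mul_one, mul_assoc, one_div_mul_eq_div]
  have : 0 ≤ radialWeight A 0 ^ (N - a) / (N - a) := by positivity
  exact (mul_le_mul_of_nonneg_left (sub_le_self _ this) hM).trans
    (mul_le_mul_of_nonneg_right (by linarith) (by positivity))

lemma lintegral_tail_zero_log (hA : Real.exp 2 ≤ A) (hN : 2 ≤ N) {a : ℝ} (ha : N < a) :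
    ∃ C > 0, ∀ R, 0 ≤ R → ∫⁻ y in {y : EuclideanSpace ℝ (Fin N) | R ≤ ‖y‖},
      ENNReal.ofReal (logProfile a 0 (weightW N A y)) ≤
      ENNReal.ofReal (C * logProfile (a - N) 0 (radialWeight A R)) := by
  have hm : 0 < a - N := by linarith
  have hM := radialMass_nonneg (N := N)
  refine ⟨(radialMass N + 1) * (1 / (a - N)), by positivity, fun R hR => ?_⟩
  have ht : Filter.Tendsto (fun r => radialWeight A r ^ (N - a) / (N - a)) Filter.atTop
      (nhds 0) := by
    have h1 := (tendsto_rpow_neg_atTop hm).comp (tendsto_radialWeight_atTop hA)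
    have h2 := h1.div_const (N - a)
    simpa [Function.comp_def] using h2
  refine (lintegral_logProfile_tail_le hA hN
    (hasDerivAt_radialWeight_rpow hA (by linarith)) ht hR).trans (ENNReal.ofReal_le_ofReal ?_)
  have hR0 := radialWeight_pos hA R
  have e : 0 - radialWeight A R ^ (N - a) / (N - a) = radialWeight A R ^ (N - a) / (a - N) := by
    rw [zero_sub, ← div_neg, neg_sub]
  rw [logProfile, Real.rpow_zero, neg_sub, mul_one, mul_assoc, one_div_mul_eq_div, e]
  gcongr
  linarith

/-- The power is split at the midpoint `(a+N)/2`: the factor of exponent `(a-N)/2 < 0` carries the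
logarithm and is almost increasing, hence bounded by its value at `R`; the remaining pure power is
integrated explicitly. The tail estimate `lintegral_tail_of_gt` uses the same split with an almost
decreasing factor. -/
lemma lintegral_ball_of_lt (hA : Real.exp 2 ≤ A) (hN : 2 ≤ N) {a : ℝ} (ha : a < N) (b : ℝ) :
    ∃ C > 0, ∀ R, 0 ≤ R → ∫⁻ y in {y : EuclideanSpace ℝ (Fin N) | ‖y‖ ≤ R},
      ENNReal.ofReal (logProfile a b (weightW N A y)) ≤
      ENNReal.ofReal (C * logProfile (a - N) b (radialWeight A R)) := by
  obtain ⟨C, hC, h⟩ := lintegral_ball_zero_log (N := N) hA hN (a := (a + N) / 2) (by linarith)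
  obtain ⟨C', hC', h'⟩ := logProfile_almost_monotone (a := (a - N) / 2) (by linarith) b
  refine ⟨C' * C, by positivity, fun R hR => ?_⟩
  have hp := logProfile_pos (a := (a - N) / 2) (b := b) (exp_one_le_radialWeight hA R)
  have e : logProfile (a - N) b (radialWeight A R) = logProfile ((a - N) / 2) b (radialWeight A R) *
      logProfile ((a + N) / 2 - N) 0 (radialWeight A R) := by
    rw [logProfile_mul (exp_one_le_radialWeight hA R)]; congr 1 <;> ring
  rw [e, show ∀ x y, C' * C * (x * y) = (C' * x) * (C * y) by intros; ring,
    ENNReal.ofReal_mul (by positivity)]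
  refine le_trans ?_ (mul_le_mul_right (h R hR) _)
  rw [← lintegral_const_mul' _ _ ENNReal.ofReal_ne_top]
  refine setLIntegral_mono' (measurableSet_le measurable_norm measurable_const) fun y hy => ?_
  rw [← ENNReal.ofReal_mul (by positivity)]
  refine ENNReal.ofReal_le_ofReal ?_
  have hy1 := exp_one_le_weightW hA y
  have e : logProfile a b (weightW N A y) = logProfile ((a - N) / 2) b (weightW N A y) *
      logProfile ((a + N) / 2) 0 (weightW N A y) := by
    rw [logProfile_mul hy1]; congr 1 <;> ring
  rw [e]
  exact mul_le_mul_of_nonneg_right (h' _ _ hy1 (radialWeight_mono (norm_nonneg _) hy))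
    (logProfile_pos hy1).le

lemma lintegral_tail_of_gt (hA : Real.exp 2 ≤ A) (hN : 2 ≤ N) {a : ℝ} (ha : N < a) (b : ℝ) :
    ∃ C > 0, ∀ R, 0 ≤ R → ∫⁻ y in {y : EuclideanSpace ℝ (Fin N) | R ≤ ‖y‖},
      ENNReal.ofReal (logProfile a b (weightW N A y)) ≤
      ENNReal.ofReal (C * logProfile (a - N) b (radialWeight A R)) := by
  obtain ⟨C, hC, h⟩ := lintegral_tail_zero_log (N := N) hA hN (a := (a + N) / 2) (by linarith)
  obtain ⟨C', hC', h'⟩ := logProfile_almost_antitone (a := (a - N) / 2) (by linarith) b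
  refine ⟨C' * C, by positivity, fun R hR => ?_⟩
  have hp := logProfile_pos (a := (a - N) / 2) (b := b) (exp_one_le_radialWeight hA R)
  have e : logProfile (a - N) b (radialWeight A R) = logProfile ((a - N) / 2) b (radialWeight A R) *
      logProfile ((a + N) / 2 - N) 0 (radialWeight A R) := by
    rw [logProfile_mul (exp_one_le_radialWeight hA R)]; congr 1 <;> ring
  rw [e, show ∀ x y, C' * C * (x * y) = (C' * x) * (C * y) by intros; ring,
    ENNReal.ofReal_mul (by positivity)]
  refine le_trans ?_ (mul_le_mul_right (h R hR) _)
  rw [← lintegral_const_mul' _ _ ENNReal.ofReal_ne_top]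
  refine setLIntegral_mono' (measurableSet_le measurable_const measurable_norm) fun y hy => ?_
  rw [← ENNReal.ofReal_mul (by positivity)]
  refine ENNReal.ofReal_le_ofReal ?_
  have hy1 := exp_one_le_weightW hA y
  have e : logProfile a b (weightW N A y) = logProfile ((a - N) / 2) b (weightW N A y) *
      logProfile ((a + N) / 2) 0 (weightW N A y) := by
    rw [logProfile_mul hy1]; congr 1 <;> ring
  rw [e]
  exact mul_le_mul_of_nonneg_right (h' _ _ (exp_one_le_radialWeight hA R)
    (radialWeight_mono hR hy)) (logProfile_pos hy1).le

/-- At the exponent `N` the radial density behaves like `log^b r / r`, so integration raises the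
power of the logarithm by one. This is the source of every `+ 1` in the logarithmic exponents below.
-/
lemma lintegral_ball_critical (hA : Real.exp 2 ≤ A) (hN : 2 ≤ N) {b : ℝ} (hb : -1 < b) :
    ∃ C > 0, ∀ R, 0 ≤ R → ∫⁻ y in {y : EuclideanSpace ℝ (Fin N) | ‖y‖ ≤ R},
      ENNReal.ofReal (logProfile N b (weightW N A y)) ≤
      ENNReal.ofReal (C * logProfile 0 (b + 1) (radialWeight A R)) := by
  have hm : 0 < b + 1 := by linarith
  have hM := radialMass_nonneg (N := N)
  refine ⟨(radialMass N + 1) * (1 / (b + 1)), by positivity, fun R hR => ?_⟩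
  refine (lintegral_logProfile_ball_le hA hN (a := N) (b := b)
    (fun r => by simpa using hasDerivAt_log_radialWeight_rpow hA hm.ne' r) hR).trans
    (ENNReal.ofReal_le_ofReal ?_)
  have h0 := one_le_log_of_exp_one_le (exp_one_le_radialWeight hA 0)
  have hR0 := one_le_log_of_exp_one_le (exp_one_le_radialWeight hA R)
  rw [logProfile, neg_zero, Real.rpow_zero, one_mul, mul_assoc, one_div_mul_eq_div]
  have : 0 ≤ Real.log (radialWeight A 0) ^ (b + 1) / (b + 1) := by positivity
  exact (mul_le_mul_of_nonneg_left (sub_le_self _ this) hM).trans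
    (mul_le_mul_of_nonneg_right (by linarith) (by positivity))

lemma lintegral_tail_critical (hA : Real.exp 2 ≤ A) (hN : 2 ≤ N) {b : ℝ} (hb : b < -1) :
    ∃ C > 0, ∀ R, 0 ≤ R → ∫⁻ y in {y : EuclideanSpace ℝ (Fin N) | R ≤ ‖y‖},
      ENNReal.ofReal (logProfile N b (weightW N A y)) ≤
      ENNReal.ofReal (C * logProfile 0 (b + 1) (radialWeight A R)) := by
  have hm : 0 < -(b + 1) := by linarith
  have hM := radialMass_nonneg (N := N)
  refine ⟨(radialMass N + 1) * (1 / -(b + 1)), by positivity, fun R hR => ?_⟩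
  have ht : Filter.Tendsto (fun r => Real.log (radialWeight A r) ^ (b + 1) / (b + 1)) Filter.atTop
      (nhds 0) := by
    have h1 := ((tendsto_rpow_neg_atTop hm).comp Real.tendsto_log_atTop).comp
      (tendsto_radialWeight_atTop hA)
    have h2 := h1.div_const (b + 1)
    simpa [Function.comp_def, -neg_add_rev] using h2
  refine (lintegral_logProfile_tail_le hA hN (a := N) (b := b)
    (fun r => by simpa using hasDerivAt_log_radialWeight_rpow hA (by linarith) r) ht hR).trans
    (ENNReal.ofReal_le_ofReal ?_)
  have hR0 := one_le_log_of_exp_one_le (exp_one_le_radialWeight hA R)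
  rw [logProfile, neg_zero, Real.rpow_zero, one_mul, mul_assoc, one_div_mul_eq_div, zero_sub,
    ← div_neg]
  gcongr
  linarith

lemma lintegral_ball_of_gt (hA : Real.exp 2 ≤ A) (hN : 2 ≤ N) {a : ℝ} (ha : N < a) (b : ℝ) :
    ∃ C > 0, ∀ R, 0 ≤ R → ∫⁻ y in {y : EuclideanSpace ℝ (Fin N) | ‖y‖ ≤ R},
      ENNReal.ofReal (logProfile a b (weightW N A y)) ≤
      ENNReal.ofReal (C * logProfile 0 0 (radialWeight A R)) := by
  obtain ⟨C, hC, h⟩ := lintegral_tail_of_gt (N := N) hA hN ha b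
  refine ⟨C * logProfile (a - N) b (radialWeight A 0),
    mul_pos hC (logProfile_pos (exp_one_le_radialWeight hA 0)), fun R _ => ?_⟩
  rw [logProfile_zero_zero, mul_one]
  exact (lintegral_mono_set fun y _ => norm_nonneg y).trans (h 0 le_rfl)

end Radial

/-! ### Decay of convolutions with the kernel `K`. -/

section Convolution

open Set ENNReal

variable {N : ℕ} {A : ℝ}

/-- When `y` is closer to `0` than to `x`, the triangle inequality makes `‖x - y‖` comparable, with
factor 2, to `‖x‖` if `‖y‖ ≤ ‖x‖` and to `‖y‖` otherwise; doubling moves `k` to that point. -/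
lemma mul_le_of_norm_le_norm_sub {E : Type*} [NormedAddCommGroup E] {k f : E → ℝ≥0∞} {D : ℝ≥0∞}
    (hk : ∀ z z', ‖z‖ ≤ 2 * ‖z'‖ → ‖z'‖ ≤ 2 * ‖z‖ → k z' ≤ D * k z) {x y : E}
    (h : ‖y‖ ≤ ‖x - y‖) :
    k (x - y) * f y ≤ D * (k x * indicator {y | ‖y‖ ≤ ‖x‖} f y +
      indicator {y | ‖x‖ ≤ ‖y‖} (fun y => k y * f y) y) := by
  have h1 : ‖x - y‖ ≤ ‖x‖ + ‖y‖ := norm_sub_le _ _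
  have h2 : ‖x‖ ≤ ‖y‖ + ‖x - y‖ := by simpa using norm_add_le y (x - y)
  rcases le_total ‖y‖ ‖x‖ with hxy | hxy
  · rw [indicator_of_mem (by exact hxy : y ∈ {y | ‖y‖ ≤ ‖x‖})]
    calc k (x - y) * f y ≤ D * k x * f y := by
          gcongr; exact hk _ _ (by linarith) (by linarith)
      _ = D * (k x * f y) := by ring
      _ ≤ _ := by gcongr; exact le_self_add
  · rw [indicator_of_mem (by exact hxy : y ∈ {y | ‖x‖ ≤ ‖y‖})]
    calc k (x - y) * f y ≤ D * k y * f y := by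
          gcongr
          exact hk _ _ (by linarith [norm_nonneg (x - y)]) (by linarith)
      _ = D * (k y * f y) := by ring
      _ ≤ _ := by gcongr; exact le_add_self

/-- A convolution bound for doubling functions. -/
theorem lintegral_sub_mul_le {E : Type*} [NormedAddCommGroup E] [MeasurableSpace E] [BorelSpace E]
    [SecondCountableTopology E]
    {μ : Measure E} [μ.IsAddLeftInvariant] [μ.IsNegInvariant]
    {k f : E → ℝ≥0∞} (hkm : Measurable k) (hfm : Measurable f) {D : ℝ≥0∞}
    (hk : ∀ z z', ‖z‖ ≤ 2 * ‖z'‖ → ‖z'‖ ≤ 2 * ‖z‖ → k z' ≤ D * k z)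
    (hf : ∀ z z', ‖z‖ ≤ 2 * ‖z'‖ → ‖z'‖ ≤ 2 * ‖z‖ → f z' ≤ D * f z) (x : E) :
    ∫⁻ y, k (x - y) * f y ∂μ ≤ D * ((k x * ∫⁻ y in {y | ‖y‖ ≤ ‖x‖}, f y ∂μ) +
      (f x * ∫⁻ y in {y | ‖y‖ ≤ ‖x‖}, k y ∂μ) + 2 * ∫⁻ y in {y | ‖x‖ ≤ ‖y‖}, k y * f y ∂μ) := by
  have m1 : MeasurableSet {y : E | ‖y‖ ≤ ‖x‖} := measurableSet_le measurable_norm measurable_const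
  have m2 : MeasurableSet {y : E | ‖x‖ ≤ ‖y‖} := measurableSet_le measurable_const measurable_norm
  set H : (E → ℝ≥0∞) → (E → ℝ≥0∞) → E → ℝ≥0∞ := fun k f y =>
    D * (k x * indicator {y | ‖y‖ ≤ ‖x‖} f y + indicator {y | ‖x‖ ≤ ‖y‖} (fun y => k y * f y) y)
    with hH
  have hHm : ∀ k f : E → ℝ≥0∞, Measurable k → Measurable f → Measurable (H k f) :=
    fun k f hk hf => (((hf.indicator m1).const_mul _).add ((hk.mul hf).indicator m2)).const_mul _
  have hHi : ∀ k f : E → ℝ≥0∞, Measurable k → Measurable f → ∫⁻ y, H k f y ∂μ =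
      D * ((k x * ∫⁻ y in {y | ‖y‖ ≤ ‖x‖}, f y ∂μ) +
        ∫⁻ y in {y | ‖x‖ ≤ ‖y‖}, k y * f y ∂μ) := fun k f hk hf => by
    have hkf : Measurable fun y => k y * f y := hk.mul hf
    have m3 : Measurable fun y => k x * indicator {y | ‖y‖ ≤ ‖x‖} f y :=
      (hf.indicator m1).const_mul _
    have m4 : Measurable fun y => k x * indicator {y | ‖y‖ ≤ ‖x‖} f y +
      indicator {y | ‖x‖ ≤ ‖y‖} (fun y => k y * f y) y := m3.add (hkf.indicator m2)
    simp only [hH]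
    rw [lintegral_const_mul _ m4, lintegral_add_left m3,
      lintegral_const_mul _ (hf.indicator m1), lintegral_indicator m1, lintegral_indicator m2]
  -- The region where `x - y` is the smaller vector becomes the previous one under `y ↦ x - y`,
  -- which exchanges `k` and `f`. The exterior term is thus met twice, hence the factor 2.
  have hp : ∀ y, k (x - y) * f y ≤ H k f y + H f k (x - y) := fun y => by
    rcases le_total ‖y‖ ‖x - y‖ with h | h
    · exact (mul_le_of_norm_le_norm_sub hk h).trans le_self_add
    · refine le_trans ?_ le_add_self
      have := mul_le_of_norm_le_norm_sub (k := f) (f := k) (D := D) hf (x := x) (y := x - y)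
        (by rwa [_root_.sub_sub_cancel])
      rwa [_root_.sub_sub_cancel, mul_comm] at this
  calc _ ≤ ∫⁻ y, H k f y + H f k (x - y) ∂μ := lintegral_mono hp
    _ = ∫⁻ y, H k f y ∂μ + ∫⁻ y, H f k y ∂μ := by
        rw [lintegral_add_left (hHm _ _ hkm hfm), lintegral_sub_left_eq_self (H f k) x]
    _ = _ := by
        rw [hHi _ _ hkm hfm, hHi _ _ hfm hkm]
        simp_rw [mul_comm (f _) (k _)]
        ring

lemma logProfile_le_of_lex {a b c d : ℝ} (h : c < a ∨ c = a ∧ b ≤ d) :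
    ∃ C > 0, ∀ t, Real.exp 1 ≤ t → logProfile a b t ≤ C * logProfile c d t := by
  rcases h with h | ⟨rfl, h⟩
  · exact logProfile_le_of_lt h b d
  · exact ⟨1, one_pos, fun t ht => by
      rw [one_mul]; exact logProfile_le_logProfile_of_log_le ht h⟩

lemma kernelK_nonneg (α β : ℝ) (x : EuclideanSpace ℝ (Fin N)) : 0 ≤ kernelK N α β x :=
  mul_nonneg (Real.rpow_nonneg (norm_nonneg _) _)
    (Real.rpow_nonneg (Real.log_nonneg (by linarith [norm_nonneg x])) _)

lemma measurable_kernelK (α β : ℝ) : Measurable (kernelK N α β) :=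
  (measurable_norm.pow_const _).mul
    ((Real.measurable_log.comp (measurable_const.add measurable_norm)).pow_const _)

lemma kernelK_le_of_one_le_norm (hA : Real.exp 2 ≤ A) (α β : ℝ) :
    ∃ C > 0, ∀ x : EuclideanSpace ℝ (Fin N), 1 ≤ ‖x‖ →
      kernelK N α β x ≤ C * logProfile α β (weightW N A x) := by
  set κ := radialWeight A 1 with hκ
  have hκ1 : 1 ≤ κ := one_le_of_exp_one_le (exp_one_le_radialWeight hA 1)
  have hlκ : 0 ≤ Real.log κ := Real.log_nonneg hκ1
  have hl2 : 0 < Real.log 2 := Real.log_pos (by norm_num)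
  -- From `w ≤ κ‖x‖` one gets `log w ≤ log κ + log (1 + ‖x‖)`, and `log (1 + ‖x‖) ≥ log 2` turns the
  -- constant into a factor. The summand 2 also covers the reverse comparison.
  set κ' := 2 + Real.log κ / Real.log 2 with hκ'
  have h0 : 0 ≤ Real.log κ / Real.log 2 := by positivity
  refine ⟨κ ^ |-α| * κ' ^ |β|, by positivity, fun x hx => ?_⟩
  have hw := exp_one_le_weightW hA x
  have hw0 := pos_of_exp_one_le hw
  have hw1 := one_le_of_exp_one_le hw
  have hxw : ‖x‖ ≤ weightW N A x := le_radialWeight hA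
  have hwx : weightW N A x ≤ κ * ‖x‖ := by
    refine (sq_le_sq₀ hw0.le (by positivity)).1 ?_
    rw [weightW_eq_radialWeight, mul_pow, hκ, radialWeight_sq hA, radialWeight_sq hA]
    nlinarith [one_le_pow₀ hx (n := 2), Real.exp_pos 2]
  have h1 := rpow_le_rpow_of_comparable (-α) hκ1 (by linarith) hw0
    (hxw.trans (by nlinarith)) hwx
  have hlw := one_le_log_of_exp_one_le hw
  have hlx : Real.log 2 ≤ Real.log (1 + ‖x‖) := Real.log_le_log (by norm_num) (by linarith)
  have hl1 : Real.log (1 + ‖x‖) ≤ 2 * Real.log (weightW N A x) := by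
    have := Real.log_le_log (by linarith) (by linarith : 1 + ‖x‖ ≤ 2 * weightW N A x)
    rw [Real.log_mul (by norm_num) hw0.ne'] at this
    linarith [Real.log_two_lt_d9]
  have hl3 : Real.log (weightW N A x) ≤ κ' * Real.log (1 + ‖x‖) := by
    have h3 := Real.log_le_log hw0 hwx
    rw [Real.log_mul (by linarith) (by linarith)] at h3
    have h4 : Real.log ‖x‖ ≤ Real.log (1 + ‖x‖) := Real.log_le_log (by linarith) (by linarith)
    have h5 : Real.log κ = Real.log κ / Real.log 2 * Real.log 2 := by field_simp
    have h6 := mul_le_mul_of_nonneg_left hlx h0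
    rw [hκ', add_mul]
    linarith
  have h2 := rpow_le_rpow_of_comparable β (by linarith : 1 ≤ κ') (by linarith) (by linarith)
    (hl1.trans (by nlinarith)) hl3
  calc kernelK N α β x ≤ (κ ^ |-α| * weightW N A x ^ (-α)) *
        (κ' ^ |β| * Real.log (weightW N A x) ^ β) :=
        mul_le_mul h1 h2 (Real.rpow_nonneg (by linarith) _) (by positivity)
    _ = _ := by unfold logProfile; ring

/-- On the unit ball `log (1 + r)` is comparable to `r`, so the kernel has the size of `r^{β-α}`;
its integrability at the origin is what `β > α - N` provides. -/
lemma lintegral_kernelK_unit_ball (hN : 2 ≤ N) {α β : ℝ} (hβ : α - N < β) :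
    ∃ M > 0, ∫⁻ y in {y : EuclideanSpace ℝ (Fin N) | ‖y‖ ≤ 1}, ENNReal.ofReal (kernelK N α β y) ≤
      ENNReal.ofReal M := by
  set g : ℝ → ℝ := fun r => 2 ^ |β| * r ^ ((N : ℝ) - 1 - α + β) with hg
  have hgi : IntegrableOn g (Ioc 0 1) := by
    have := (intervalIntegral.intervalIntegrable_rpow' (a := 0) (b := 1)
      (by linarith : -1 < (N : ℝ) - 1 - α + β)).const_mul (2 ^ |β|)
    exact (intervalIntegrable_iff_integrableOn_Ioc_of_le zero_le_one).1 this
  have h := setLIntegral_radial_le hN (F := fun r => r ^ (-α) * Real.log (1 + r) ^ β)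
    (g := g) (S := Icc 0 1) (T := Ioc 0 1) measurableSet_Icc measurableSet_Ioc
    (fun r hr => ⟨hr.2, hr.1.2⟩)
    ((measurable_id.pow_const _).mul
      ((Real.measurable_log.comp (measurable_const.add measurable_id)).pow_const _))
    (fun r hr => mul_nonneg (Real.rpow_nonneg hr.1 _)
      (Real.rpow_nonneg (Real.log_nonneg (by linarith [hr.1])) _)) hgi
    (fun r hr => mul_nonneg (by positivity) (Real.rpow_nonneg hr.1.le _)) (fun r hr hr0 => by
      have e1 : Real.log (1 + r) ≤ r := by
        have := Real.log_le_sub_one_of_pos (by linarith : 0 < 1 + r); linarith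
      have e2 : r ≤ 2 * Real.log (1 + r) := by
        have h1 := Real.one_sub_inv_le_log_of_pos (by linarith : 0 < 1 + r)
        have h2 : r / 2 ≤ 1 - (1 + r)⁻¹ := by
          have : 1 - (1 + r)⁻¹ = r / (1 + r) := by field_simp; ring
          rw [this]
          exact div_le_div_of_nonneg_left hr0.le (by linarith) (by linarith [hr.2])
        linarith
      have e3 := rpow_le_rpow_of_comparable β one_le_two (by linarith : 0 < Real.log (1 + r)) hr0
        (by linarith) e2
      have e4 : r ^ (N - 1) = r ^ ((N : ℝ) - 1) := by
        rw [← Real.rpow_natCast, Nat.cast_sub (by omega), Nat.cast_one]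
      rw [hg, e4]
      calc r ^ ((N : ℝ) - 1) * (r ^ (-α) * Real.log (1 + r) ^ β)
          ≤ r ^ ((N : ℝ) - 1) * (r ^ (-α) * (2 ^ |β| * r ^ β)) := by gcongr
        _ = 2 ^ |β| * (r ^ ((N : ℝ) - 1) * r ^ (-α) * r ^ β) := by ring
        _ = _ := by
          rw [← Real.rpow_add hr0, ← Real.rpow_add hr0]; rfl)
  have e : {y : EuclideanSpace ℝ (Fin N) | ‖y‖ ∈ Icc (0 : ℝ) 1} =
      {y : EuclideanSpace ℝ (Fin N) | ‖y‖ ≤ 1} := by ext; simp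
  rw [e] at h
  exact ⟨max _ 1, by positivity, h.trans (ENNReal.ofReal_le_ofReal (le_max_left _ 1))⟩

lemma logProfile_weightW_doubling (hA : Real.exp 2 ≤ A) (a b : ℝ) :
    ∃ D ≥ 1, ∀ z z' : EuclideanSpace ℝ (Fin N), ‖z‖ ≤ 2 * ‖z'‖ → ‖z'‖ ≤ 2 * ‖z‖ →
      logProfile a b (weightW N A z') ≤ D * logProfile a b (weightW N A z) := by
  obtain ⟨D, hD, h⟩ := logProfile_comparable one_le_two a b
  exact ⟨D, hD, fun z z' h1 h2 => h _ _ (exp_one_le_weightW hA _) (exp_one_le_weightW hA _)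
    (radialWeight_le_mul hA (norm_nonneg _) one_le_two h2)
    (radialWeight_le_mul hA (norm_nonneg _) one_le_two h1)⟩

/-- The hypotheses treat the three terms of `lintegral_sub_mul_le`. The exponents `c - α, d - β` and
`c - a, d - b` are what is left of the target after dividing by the profile evaluated at `x`. -/
lemma lintegral_logProfile_convolution_le (hA : Real.exp 2 ≤ A) {α β a b c d : ℝ}
    (h1 : ∃ C > 0, ∀ R, 0 ≤ R → ∫⁻ y in {y : EuclideanSpace ℝ (Fin N) | ‖y‖ ≤ R},
      ENNReal.ofReal (logProfile a b (weightW N A y)) ≤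
      ENNReal.ofReal (C * logProfile (c - α) (d - β) (radialWeight A R)))
    (h2 : ∃ C > 0, ∀ R, 0 ≤ R → ∫⁻ y in {y : EuclideanSpace ℝ (Fin N) | ‖y‖ ≤ R},
      ENNReal.ofReal (logProfile α β (weightW N A y)) ≤
      ENNReal.ofReal (C * logProfile (c - a) (d - b) (radialWeight A R)))
    (h3 : ∃ C > 0, ∀ R, 0 ≤ R → ∫⁻ y in {y : EuclideanSpace ℝ (Fin N) | R ≤ ‖y‖},
      ENNReal.ofReal (logProfile (α + a) (β + b) (weightW N A y)) ≤
      ENNReal.ofReal (C * logProfile c d (radialWeight A R))) :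
    ∃ C > 0, ∀ x : EuclideanSpace ℝ (Fin N), ∫⁻ y, ENNReal.ofReal
      (logProfile α β (weightW N A (x - y)) * logProfile a b (weightW N A y)) ≤
      ENNReal.ofReal (C * logProfile c d (weightW N A x)) := by
  obtain ⟨C1, hC1, h1⟩ := h1
  obtain ⟨C2, hC2, h2⟩ := h2
  obtain ⟨C3, hC3, h3⟩ := h3
  obtain ⟨D1, hD1, hd1⟩ := logProfile_weightW_doubling (N := N) hA α β
  obtain ⟨D2, hD2, hd2⟩ := logProfile_weightW_doubling (N := N) hA a b
  have hpos : ∀ a b, ∀ x : EuclideanSpace ℝ (Fin N), 0 < logProfile a b (weightW N A x) :=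
    fun a b x => logProfile_pos (exp_one_le_weightW hA x)
  set D := max D1 D2 with hD
  have hD0 : 0 < D := lt_of_lt_of_le (by linarith) (le_max_left D1 D2)
  refine ⟨D * (C1 + C2 + 2 * C3), by positivity, fun x => ?_⟩
  have key := lintegral_sub_mul_le (μ := (volume : Measure (EuclideanSpace ℝ (Fin N))))
    (k := fun x => ENNReal.ofReal (logProfile α β (weightW N A x)))
    (f := fun x => ENNReal.ofReal (logProfile a b (weightW N A x)))
    (continuous_logProfile_weightW hA _ _).measurable.ennreal_ofReal
    (continuous_logProfile_weightW hA _ _).measurable.ennreal_ofReal (D := ENNReal.ofReal D)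
    (fun z z' h h' => by
      rw [← ENNReal.ofReal_mul hD0.le]
      exact ENNReal.ofReal_le_ofReal ((hd1 z z' h h').trans
        (mul_le_mul_of_nonneg_right (le_max_left _ _) (hpos _ _ _).le)))
    (fun z z' h h' => by
      rw [← ENNReal.ofReal_mul hD0.le]
      exact ENNReal.ofReal_le_ofReal ((hd2 z z' h h').trans
        (mul_le_mul_of_nonneg_right (le_max_right _ _) (hpos _ _ _).le))) x
  have e : ∀ y : EuclideanSpace ℝ (Fin N), logProfile α β (weightW N A y) *
      logProfile a b (weightW N A y) = logProfile (α + a) (β + b) (weightW N A y) := fun y =>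
    logProfile_mul (exp_one_le_weightW hA y)
  simp_rw [← ENNReal.ofReal_mul (hpos _ _ _).le, e] at key
  refine key.trans ?_
  have hw := exp_one_le_weightW hA x
  have p1 := hpos α β x
  have p2 := hpos a b x
  have p3 := hpos c d x
  have p4 := hpos (c - α) (d - β) x
  have p5 := hpos (c - a) (d - b) x
  have q1 : logProfile α β (weightW N A x) * logProfile (c - α) (d - β) (weightW N A x) =
      logProfile c d (weightW N A x) := by rw [logProfile_mul hw]; congr 1 <;> ring
  have q2 : logProfile a b (weightW N A x) * logProfile (c - a) (d - b) (weightW N A x) =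
      logProfile c d (weightW N A x) := by rw [logProfile_mul hw]; congr 1 <;> ring
  have n0 := norm_nonneg x
  calc _ ≤ ENNReal.ofReal D * (ENNReal.ofReal (logProfile α β (weightW N A x)) *
          ENNReal.ofReal (C1 * logProfile (c - α) (d - β) (weightW N A x)) +
        ENNReal.ofReal (logProfile a b (weightW N A x)) *
          ENNReal.ofReal (C2 * logProfile (c - a) (d - b) (weightW N A x)) +
        2 * ENNReal.ofReal (C3 * logProfile c d (weightW N A x))) := by
        gcongr
        · exact h1 _ n0
        · exact h2 _ n0
        · exact h3 _ n0
    _ = ENNReal.ofReal (D * (C1 + C2 + 2 * C3) * logProfile c d (weightW N A x)) := by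
        rw [show (2 : ℝ≥0∞) = ENNReal.ofReal 2 by simp, ← ENNReal.ofReal_mul p1.le,
          ← ENNReal.ofReal_mul p2.le, ← ENNReal.ofReal_mul zero_le_two,
          ← ENNReal.ofReal_add (by positivity) (by positivity),
          ← ENNReal.ofReal_add (by positivity) (by positivity), ← ENNReal.ofReal_mul hD0.le]
        congr 1
        calc _ = D * (C1 * (logProfile α β (weightW N A x) *
              logProfile (c - α) (d - β) (weightW N A x)) + C2 * (logProfile a b (weightW N A x) *
              logProfile (c - a) (d - b) (weightW N A x)) +
              2 * (C3 * logProfile c d (weightW N A x))) := by ring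
          _ = _ := by rw [q1, q2]; ring

/-- The true kernel differs from its profile essentially by its local singularity. For `‖x - y‖ ≤ 1`
the weights at `x` and `y` are comparable, and the finite local mass contributes `w^{-a} log^b w`,
which `c < a` makes negligible. -/
lemma lintegral_kernelK_mul_le (hA : Real.exp 2 ≤ A) (hN : 2 ≤ N) {α β a b c d : ℝ}
    (hβ : α - N < β) (h0 : c < a)
    (h : ∃ C > 0, ∀ x : EuclideanSpace ℝ (Fin N), ∫⁻ y, ENNReal.ofReal
      (logProfile α β (weightW N A (x - y)) * logProfile a b (weightW N A y)) ≤
      ENNReal.ofReal (C * logProfile c d (weightW N A x))) :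
    ∃ C > 0, ∀ x : EuclideanSpace ℝ (Fin N), ∫⁻ y, ENNReal.ofReal
      (kernelK N α β (x - y) * logProfile a b (weightW N A y)) ≤
      ENNReal.ofReal (C * logProfile c d (weightW N A x)) := by
  obtain ⟨C1, hC1, h⟩ := h
  obtain ⟨C2, hC2, h2⟩ := kernelK_le_of_one_le_norm (N := N) hA α β
  obtain ⟨M, hM, h3⟩ := lintegral_kernelK_unit_ball (N := N) hN hβ
  obtain ⟨D, hD, h4⟩ := logProfile_comparable one_le_two a b
  obtain ⟨C5, hC5, h5⟩ := logProfile_le_of_lt h0 b d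
  refine ⟨M * (D * C5) + C2 * C1, by positivity, fun x => ?_⟩
  have hpos : ∀ a b, ∀ x : EuclideanSpace ℝ (Fin N), 0 < logProfile a b (weightW N A x) :=
    fun a b x => logProfile_pos (exp_one_le_weightW hA x)
  have hms : MeasurableSet {y : EuclideanSpace ℝ (Fin N) | ‖y‖ ≤ 1} :=
    measurableSet_le measurable_norm measurable_const
  set near : EuclideanSpace ℝ (Fin N) → ℝ≥0∞ :=
    indicator {y | ‖y‖ ≤ 1} fun y => ENNReal.ofReal (kernelK N α β y) with hnear
  have hnm : Measurable near := (measurable_kernelK α β).ennreal_ofReal.indicator hms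
  have hp : ∀ y, ENNReal.ofReal (kernelK N α β (x - y) * logProfile a b (weightW N A y)) ≤
      near (x - y) * ENNReal.ofReal (D * logProfile a b (weightW N A x)) +
      ENNReal.ofReal C2 * ENNReal.ofReal
        (logProfile α β (weightW N A (x - y)) * logProfile a b (weightW N A y)) := fun y => by
    rcases le_total ‖x - y‖ 1 with hxy | hxy
    · refine le_trans ?_ le_self_add
      rw [hnear, indicator_of_mem (by exact hxy), ← ENNReal.ofReal_mul (kernelK_nonneg _ _ _)]
      refine ENNReal.ofReal_le_ofReal (mul_le_mul_of_nonneg_left ?_ (kernelK_nonneg _ _ _))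
      have w1 := weightW_le_of_norm_sub_le hA hxy
      have w2 := weightW_le_of_norm_sub_le (x := y) (y := x) (s := 1) hA (by rwa [norm_sub_rev])
      rw [one_add_one_eq_two] at w1 w2
      exact h4 _ _ (exp_one_le_weightW hA _) (exp_one_le_weightW hA _) w2 w1
    · refine le_trans ?_ le_add_self
      rw [← ENNReal.ofReal_mul hC2.le, ← mul_assoc]
      exact ENNReal.ofReal_le_ofReal (mul_le_mul_of_nonneg_right (h2 _ hxy) (hpos _ _ _).le)
  calc _ ≤ ∫⁻ y, near (x - y) * ENNReal.ofReal (D * logProfile a b (weightW N A x)) +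
        ENNReal.ofReal C2 * ENNReal.ofReal
          (logProfile α β (weightW N A (x - y)) * logProfile a b (weightW N A y)) :=
        lintegral_mono hp
    _ = (∫⁻ y, near y) * ENNReal.ofReal (D * logProfile a b (weightW N A x)) +
        ENNReal.ofReal C2 * ∫⁻ y, ENNReal.ofReal
          (logProfile α β (weightW N A (x - y)) * logProfile a b (weightW N A y)) := by
        have hm : Measurable fun y => near (x - y) := hnm.comp (measurable_const.sub measurable_id)
        rw [lintegral_add_left (hm.mul_const _),
          lintegral_const_mul' _ _ ENNReal.ofReal_ne_top,
          lintegral_mul_const' _ _ ENNReal.ofReal_ne_top, lintegral_sub_left_eq_self near x]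
    _ ≤ ENNReal.ofReal M * ENNReal.ofReal (D * (C5 * logProfile c d (weightW N A x))) +
        ENNReal.ofReal C2 * ENNReal.ofReal (C1 * logProfile c d (weightW N A x)) := by
        rw [hnear, lintegral_indicator hms]
        gcongr
        · exact h5 _ (exp_one_le_weightW hA x)
        · exact h x
    _ = _ := by
        have := hpos c d x
        rw [← ENNReal.ofReal_mul hM.le, ← ENNReal.ofReal_mul hC2.le,
          ← ENNReal.ofReal_add (by positivity) (by positivity)]
        congr 1
        ring

/-- The four regimes for the decay of `K_{α,β} * (w^{-a} log^b w)`. -/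
theorem kernelK_convolution_decay (hA : Real.exp 2 ≤ A) (hN : 2 ≤ N) {α β a b c d : ℝ}
    (hα0 : 0 ≤ α) (hαN : α < N) (hβ : α - N < β)
    (h : (N < a ∧ c = α ∧ d = β) ∨
      (N - α < a ∧ a < N ∧ c = α + a - N ∧ d = β + b) ∨
      (a = N ∧ -1 < b ∧ (0 < α ∨ β + b < -1) ∧ c = α ∧ d = β + b + 1) ∨
      (a = N - α ∧ -1 < b ∧ β + b < -1 ∧ c = 0 ∧ d = β + b + 1)) :
    ∃ C > 0, ∀ x : EuclideanSpace ℝ (Fin N), ∫⁻ y, ENNReal.ofReal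
      (kernelK N α β (x - y) * logProfile a b (weightW N A y)) ≤
      ENNReal.ofReal (C * logProfile c d (weightW N A x)) := by
  have weaken : ∀ {S : ℝ → Set (EuclideanSpace ℝ (Fin N))} {f : EuclideanSpace ℝ (Fin N) → ℝ≥0∞}
      {c d : ℝ} (c' d' : ℝ), (∃ C > 0, ∀ R, 0 ≤ R → ∫⁻ y in S R, f y ≤
        ENNReal.ofReal (C * logProfile c d (radialWeight A R))) → (c' < c ∨ c' = c ∧ d ≤ d') →
      (∃ C > 0, ∀ R, 0 ≤ R → ∫⁻ y in S R, f y ≤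
        ENNReal.ofReal (C * logProfile c' d' (radialWeight A R))) := by
    rintro S f c d c' d' ⟨C, hC, h⟩ hl
    obtain ⟨C', hC', h'⟩ := logProfile_le_of_lex hl
    refine ⟨C * C', by positivity, fun R hR => (h R hR).trans (ENNReal.ofReal_le_ofReal ?_)⟩
    rw [mul_assoc]
    exact mul_le_mul_of_nonneg_left (h' _ (exp_one_le_radialWeight hA R)) hC.le
  have hb := lintegral_ball_of_lt (N := N) hA hN hαN β
  rcases h with ⟨ha, rfl, rfl⟩ | ⟨ha, ha', rfl, rfl⟩ | ⟨rfl, hb1, h, rfl, rfl⟩ |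
    ⟨rfl, hb1, h, rfl, rfl⟩
  -- For `a > N` the density has finite mass, so the convolution inherits the decay of the kernel.
  · refine lintegral_kernelK_mul_le hA hN hβ (by linarith)
      (lintegral_logProfile_convolution_le hA ?_ ?_ ?_)
    · exact weaken _ _ (lintegral_ball_of_gt hA hN ha b) (Or.inr ⟨by ring, by simp⟩)
    · exact weaken _ _ hb (Or.inl (by linarith))
    · exact weaken _ _ (lintegral_tail_of_gt hA hN (by linarith) _) (Or.inl (by linarith))
  -- For `N - α < a < N` the three terms are of the same order.
  · refine lintegral_kernelK_mul_le hA hN hβ (by linarith)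
      (lintegral_logProfile_convolution_le hA ?_ ?_ ?_)
    · exact weaken _ _ (lintegral_ball_of_lt hA hN ha' b) (Or.inr ⟨by ring, by simp⟩)
    · exact weaken _ _ hb (Or.inr ⟨by ring, by simp⟩)
    · exact weaken _ _ (lintegral_tail_of_gt hA hN (by linarith) _) (Or.inr ⟨by ring, le_rfl⟩)
  -- For `a = N` the mass in a ball gains one logarithm. The exterior term has exponent `α + N`,
  -- which becomes critical when `α = 0`; only then is `β + b < -1` needed.
  · refine lintegral_kernelK_mul_le hA hN hβ (by linarith)
      (lintegral_logProfile_convolution_le hA ?_ ?_ ?_)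
    · exact weaken _ _ (lintegral_ball_critical hA hN hb1) (Or.inr ⟨by ring, by linarith⟩)
    · exact weaken _ _ hb (Or.inr ⟨by ring, by linarith⟩)
    · rcases hα0.eq_or_lt with rfl | hα
      · have := lintegral_tail_critical (N := N) hA hN (h.resolve_left (lt_irrefl _))
        rw [zero_add]
        exact this
      · exact weaken _ _ (lintegral_tail_of_gt hA hN (by linarith) _)
          (Or.inr ⟨by ring, by linarith⟩)
  -- For `a = N - α` the exterior term has the critical exponent `N` and converges only through `β +
  -- b < -1`, leaving no power decay. For `α = 0` the ball integral of the density is critical as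
  -- well.
  · refine lintegral_kernelK_mul_le hA hN hβ (by linarith)
      (lintegral_logProfile_convolution_le hA ?_ ?_ ?_)
    · rcases hα0.eq_or_lt with rfl | hα
      · have := lintegral_ball_critical (N := N) hA hN hb1
        rw [sub_zero, sub_zero]
        exact weaken _ _ this (Or.inr ⟨rfl, by linarith⟩)
      · exact weaken _ _ (lintegral_ball_of_lt hA hN (by linarith) b)
          (Or.inr ⟨by ring, by linarith⟩)
    · exact weaken _ _ hb (Or.inr ⟨by ring, by linarith⟩)
    · have := lintegral_tail_critical (N := N) hA hN h
      rw [show α + (N - α) = N by ring]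
      exact this

end Convolution

/-! ### Derivatives of a profile of `w` are bounded by the profile. -/

section DerivativeBounds

open Set Topology

/-- The profile `s^α (ℓ + (log s) / 2)^b`, obtained from `logProfile` by rescaling. -/
noncomputable def scaledProfile (l a b s : ℝ) : ℝ := s ^ a * (l + Real.log s / 2) ^ b

lemma isOpen_scaledProfile_domain (l : ℝ) : IsOpen {s : ℝ | 0 < s ∧ 0 < l + Real.log s / 2} := by
  have hc : ContinuousOn (fun s : ℝ => l + Real.log s / 2) (Ioi 0) :=
    continuousOn_const.add ((Real.continuousOn_log.mono fun s hs => ne_of_gt hs).div_const 2)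
  exact hc.isOpen_inter_preimage isOpen_Ioi isOpen_Ioi

lemma contDiffAt_scaledProfile {l s : ℝ} (a b : ℝ) {n : WithTop ℕ∞} (hs : 0 < s)
    (hl : 0 < l + Real.log s / 2) : ContDiffAt ℝ n (scaledProfile l a b) s :=
  (contDiffAt_id.rpow_const_of_ne hs.ne').mul
    ((contDiffAt_const.add ((Real.contDiffAt_log.2 hs.ne').div_const 2)).rpow_const_of_ne hl.ne')

lemma deriv_scaledProfile {l s : ℝ} (a b : ℝ) (hs : 0 < s) (hl : 0 < l + Real.log s / 2) :
    deriv (scaledProfile l a b) s =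
      a * scaledProfile l (a - 1) b s + b / 2 * scaledProfile l (a - 1) (b - 1) s := by
  have h1 := Real.hasDerivAt_rpow_const (p := a) (Or.inl hs.ne')
  have h2 := (((Real.hasDerivAt_log hs.ne').div_const 2).const_add l).rpow_const (p := b)
    (Or.inl hl.ne')
  have h3 : deriv (scaledProfile l a b) s = _ := (h1.mul h2).deriv
  rw [h3, scaledProfile, scaledProfile, Real.rpow_sub_one hs.ne']
  field_simp

/-- Differentiation stays within the family, lowering `b` by at most one, and `l^{b-1} ≤ l^b` for `l
≥ 1`. What matters is that `C` is uniform in `l`, which will be `log w(x)`. -/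
lemma abs_iteratedDeriv_scaledProfile_le (n : ℕ) : ∀ a b : ℝ, ∃ C, 0 ≤ C ∧ ∀ l, 1 ≤ l →
    |iteratedDeriv n (scaledProfile l a b) 1| ≤ C * l ^ b := by
  induction n with
  | zero => exact fun a b => ⟨1, zero_le_one, fun l hl => by
      have : 0 ≤ l ^ b := by positivity
      simp [scaledProfile, abs_of_nonneg this]⟩
  | succ n ih =>
    intro a b
    obtain ⟨C1, hC1, h1⟩ := ih (a - 1) b
    obtain ⟨C2, hC2, h2⟩ := ih (a - 1) (b - 1)
    refine ⟨|a| * C1 + |b / 2| * C2, by positivity, fun l hl => ?_⟩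
    have hmem : (1 : ℝ) ∈ {s : ℝ | 0 < s ∧ 0 < l + Real.log s / 2} := by
      simp; linarith
    have hd : deriv (scaledProfile l a b) =ᶠ[𝓝 1] (fun s => a * scaledProfile l (a - 1) b s) +
        fun s => b / 2 * scaledProfile l (a - 1) (b - 1) s := by
      filter_upwards [(isOpen_scaledProfile_domain l).mem_nhds hmem] with s hs
      exact deriv_scaledProfile a b hs.1 hs.2
    have hc : ∀ a b, ContDiffAt ℝ n (scaledProfile l a b) 1 := fun a b =>
      contDiffAt_scaledProfile a b hmem.1 hmem.2
    rw [iteratedDeriv_succ', hd.iteratedDeriv_eq,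
      iteratedDeriv_add (contDiffAt_const.mul (hc _ _)) (contDiffAt_const.mul (hc _ _)),
      iteratedDeriv_const_mul_field, iteratedDeriv_const_mul_field]
    have hb : l ^ (b - 1) ≤ l ^ b := Real.rpow_le_rpow_of_exponent_le hl (by linarith)
    calc _ ≤ |a| * (C1 * l ^ b) + |b / 2| * (C2 * l ^ (b - 1)) := by
          refine (abs_add_le _ _).trans ?_
          rw [abs_mul, abs_mul]
          gcongr
          · exact h1 l hl
          · exact h2 l hl
      _ ≤ |a| * (C1 * l ^ b) + |b / 2| * (C2 * l ^ b) := by gcongr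
      _ = _ := by ring

variable {E : Type*} [NormedAddCommGroup E] [InnerProductSpace ℝ E]

lemma fderiv_const_mul_add_norm_sq (c A : ℝ) :
    fderiv ℝ (fun y : E => c * (A + ‖y‖ ^ 2)) = fun y => (2 * c) • innerSL ℝ y := by
  ext1 y
  have h := ((hasStrictFDerivAt_norm_sq y).hasFDerivAt.const_add A).const_mul c
  rw [h.fderiv]
  ext z
  simp
  ring

/-- A quadratic has derivatives of norm at most `2c‖x‖`, `2c` and then zero. The form `2 ^ i` is the
one required by the bound on derivatives of a composition. -/
lemma norm_iteratedFDeriv_const_mul_add_norm_sq_le {c A : ℝ} (hc : 0 ≤ c) (hc1 : c ≤ 1) {x : E}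
    (hx : c * ‖x‖ ≤ 1) (i : ℕ) (hi : 1 ≤ i) :
    ‖iteratedFDeriv ℝ i (fun y : E => c * (A + ‖y‖ ^ 2)) x‖ ≤ 2 ^ i := by
  obtain ⟨j, rfl⟩ := Nat.exists_eq_add_of_le' hi
  rw [← norm_iteratedFDeriv_fderiv, fderiv_const_mul_add_norm_sq]
  rcases j with _ | j
  · rw [norm_iteratedFDeriv_zero, norm_smul, Real.norm_of_nonneg (by positivity),
      innerSL_apply_norm]
    norm_num
    linarith
  · have e : (fun y : E => (2 * c) • innerSL ℝ y) = ((2 * c) • innerSL ℝ : E →L[ℝ] E →L[ℝ] ℝ) := by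
      ext; simp
    have e2 : fderiv ℝ (fun y : E => (2 * c) • innerSL ℝ y) =
        fun _ => ((2 * c) • innerSL ℝ : E →L[ℝ] E →L[ℝ] ℝ) := by
      ext1 y
      rw [e, ContinuousLinearMap.fderiv]
    rw [← norm_iteratedFDeriv_fderiv, e2]
    rcases j with _ | j
    · rw [norm_iteratedFDeriv_zero]
      refine ContinuousLinearMap.opNorm_le_bound _ (by norm_num) fun y => ?_
      rw [_root_.smul_apply, norm_smul, Real.norm_of_nonneg (by positivity),
        innerSL_apply_norm]
      norm_num
      nlinarith [norm_nonneg y]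
    · rw [iteratedFDeriv_const_of_ne (by simp)]
      simp

variable {N : ℕ} {A : ℝ}

/-- Rescaling at `x`: with `s = w(y)²/w(x)²` one has `log w(y) = log w(x) + (log s)/2`, and `y = x`
corresponds to `s = 1`. The size of the profile is carried by the prefactor and `l^b`. -/
lemma logProfile_weightW_eq (hA : Real.exp 2 ≤ A) (a b : ℝ)
    (x y : EuclideanSpace ℝ (Fin N)) : logProfile a b (weightW N A y) =
      weightW N A x ^ (-a) * scaledProfile (Real.log (weightW N A x)) (-a / 2) b
        ((weightW N A x ^ 2)⁻¹ * (A + ‖y‖ ^ 2)) := by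
  have hx := pos_of_exp_one_le (exp_one_le_weightW hA x)
  have hy := pos_of_exp_one_le (exp_one_le_weightW hA y)
  rw [← radialWeight_sq hA, ← weightW_eq_radialWeight, ← inv_pow, ← mul_pow, scaledProfile,
    Real.log_pow, Real.log_mul (by positivity) hy.ne', Real.log_inv, logProfile,
    ← Real.rpow_natCast, ← Real.rpow_mul (by positivity)]
  rw [show ((2 : ℕ) : ℝ) * (-a / 2) = -a by push_cast; ring,
    Real.mul_rpow (by positivity) hy.le, Real.inv_rpow hx.le, ← mul_assoc, ← mul_assoc,
    mul_inv_cancel₀ (by positivity), one_mul]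
  congr 2
  push_cast
  ring

lemma scaledProfile_domain (hA : Real.exp 2 ≤ A) (x y : EuclideanSpace ℝ (Fin N)) :
    0 < (weightW N A x ^ 2)⁻¹ * (A + ‖y‖ ^ 2) ∧ 0 < Real.log (weightW N A x) +
      Real.log ((weightW N A x ^ 2)⁻¹ * (A + ‖y‖ ^ 2)) / 2 := by
  have hx := pos_of_exp_one_le (exp_one_le_weightW hA x)
  have hy := pos_of_exp_one_le (exp_one_le_weightW hA y)
  have hl := one_le_log_of_exp_one_le (exp_one_le_weightW hA y)
  rw [← radialWeight_sq hA, ← weightW_eq_radialWeight]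
  refine ⟨by positivity, ?_⟩
  rw [← inv_pow, ← mul_pow, Real.log_pow, Real.log_mul (by positivity) hy.ne', Real.log_inv]
  push_cast
  linarith

lemma contDiff_logProfile_weightW (hA : Real.exp 2 ≤ A) (a b : ℝ) (n : WithTop ℕ∞) :
    ContDiff ℝ n fun y : EuclideanSpace ℝ (Fin N) => logProfile a b (weightW N A y) := by
  have e : (fun y : EuclideanSpace ℝ (Fin N) => logProfile a b (weightW N A y)) = _ :=
    funext fun y => logProfile_weightW_eq hA a b 0 y
  rw [e]
  refine contDiff_const.mul (contDiff_iff_contDiffAt.2 fun y => ?_)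
  have h := scaledProfile_domain hA 0 y
  exact (contDiffAt_scaledProfile _ _ h.1 h.2).comp y
    (contDiffAt_const.mul (contDiffAt_const.add (contDiff_norm_sq ℝ).contDiffAt))

theorem norm_iteratedFDeriv_logProfile_weightW_le (hA : Real.exp 2 ≤ A) (a b : ℝ) (n : ℕ) :
    ∃ C > 0, ∀ x : EuclideanSpace ℝ (Fin N),
      ‖iteratedFDeriv ℝ n (fun y => logProfile a b (weightW N A y)) x‖ ≤
        C * logProfile a b (weightW N A x) := by
  choose C hC0 hC using fun i => abs_iteratedDeriv_scaledProfile_le i (-a / 2) b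
  set M := ∑ i ∈ Finset.range (n + 1), C i with hM
  have hM0 : 0 ≤ M := Finset.sum_nonneg fun i _ => hC0 i
  refine ⟨n.factorial * (M + 1) * 2 ^ n, by positivity, fun x => ?_⟩
  have hw := exp_one_le_weightW hA x
  have hx := pos_of_exp_one_le hw
  have hl := one_le_log_of_exp_one_le hw
  have hw1 := one_le_of_exp_one_le hw
  set l := Real.log (weightW N A x) with hl_def
  set c := (weightW N A x ^ 2)⁻¹ with hc
  have hcpos : 0 < c := by positivity
  set f : EuclideanSpace ℝ (Fin N) → ℝ := fun y => c * (A + ‖y‖ ^ 2) with hf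
  have hfx : f x = 1 := by
    rw [hf]
    simp only
    rw [← radialWeight_sq hA, ← weightW_eq_radialWeight, hc, inv_mul_cancel₀ (by positivity)]
  set t := {s : ℝ | 0 < s ∧ 0 < l + Real.log s / 2} with ht
  have hto : IsOpen t := isOpen_scaledProfile_domain l
  have hmaps : MapsTo f univ t := fun y _ => scaledProfile_domain hA x y
  have hfc : ContDiff ℝ n f := contDiff_const.mul (contDiff_const.add (contDiff_norm_sq ℝ))
  have hgc : ContDiffOn ℝ n (scaledProfile l (-a / 2) b) t := fun s hs =>
    (contDiffAt_scaledProfile _ _ hs.1 hs.2).contDiffWithinAt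
  have hc1 : c ≤ 1 := inv_le_one_of_one_le₀ (one_le_pow₀ hw1)
  have hcx : c * ‖x‖ ≤ 1 := by
    rw [hc, inv_mul_le_iff₀ (by positivity), mul_one]
    have : ‖x‖ ≤ weightW N A x := le_radialWeight hA
    nlinarith
  -- A Faà di Bruno bound. It is applied within the open set `t`, since the outer function need not
  -- be smooth outside it.
  have key := norm_iteratedFDerivWithin_comp_le (n := n) (x := x) (s := univ) (t := t) hgc
    hfc.contDiffOn le_rfl hto.uniqueDiffOn uniqueDiffOn_univ hmaps (mem_univ _)
    (C := M * l ^ b) (D := 2) (fun i hi => by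
      rw [iteratedFDerivWithin_of_isOpen i hto (hmaps (mem_univ x)),
        norm_iteratedFDeriv_eq_norm_iteratedDeriv, hfx]
      refine (hC i l hl).trans ?_
      gcongr
      exact Finset.single_le_sum (f := C) (fun i _ => hC0 i) (Finset.mem_range.2 (by omega)))
    (fun i hi _ => by
      rw [iteratedFDerivWithin_univ]
      exact norm_iteratedFDeriv_const_mul_add_norm_sq_le hcpos.le hc1 hcx i hi)
  rw [iteratedFDerivWithin_univ] at key
  have e : (fun y : EuclideanSpace ℝ (Fin N) => logProfile a b (weightW N A y)) =
      (weightW N A x ^ (-a)) • (scaledProfile l (-a / 2) b ∘ f) :=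
    funext fun y => logProfile_weightW_eq hA a b x y
  have hcomp : ContDiff ℝ n (scaledProfile l (-a / 2) b ∘ f) :=
    contDiff_iff_contDiffAt.2 fun y =>
      (contDiffAt_scaledProfile _ _ (hmaps (mem_univ y)).1 (hmaps (mem_univ y)).2).comp y
        hfc.contDiffAt
  rw [e, iteratedFDeriv_const_smul_apply hcomp.contDiffAt, norm_smul,
    Real.norm_of_nonneg (by positivity), logProfile]
  calc _ ≤ weightW N A x ^ (-a) * (n.factorial * (M * l ^ b) * 2 ^ n) := by gcongr
    _ = n.factorial * M * 2 ^ n * (weightW N A x ^ (-a) * l ^ b) := by ring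
    _ ≤ _ := by gcongr; linarith

end DerivativeBounds

/-! ### Smoothness of Newtonian potentials of decaying functions. -/

section Potential

open Set Topology

variable {N : ℕ} {A : ℝ}

/-- `g` is continuous and `O(w^{-N})`. -/
def HasDecay (N : ℕ) (A : ℝ) {F : Type*} [NormedAddCommGroup F]
    (g : EuclideanSpace ℝ (Fin N) → F) : Prop :=
  Continuous g ∧ ∃ C > 0, ∀ x, ‖g x‖ ≤ C * logProfile N 0 (weightW N A x)

/-- A Peetre-type inequality: translation by a bounded `x` costs only a constant, which gives
dominating functions that are locally uniform in `x`. -/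
lemma logProfile_sub_le (hA : Real.exp 2 ≤ A) (x y : EuclideanSpace ℝ (Fin N)) :
    logProfile N 0 (weightW N A (x - y)) ≤
      (1 + ‖x‖) ^ (N : ℝ) * logProfile N 0 (weightW N A y) := by
  have h1 := pos_of_exp_one_le (exp_one_le_weightW hA (x - y))
  have h2 := pos_of_exp_one_le (exp_one_le_weightW hA y)
  have h3 : weightW N A y ≤ (1 + ‖x‖) * weightW N A (x - y) := by
    have : weightW N A (x - y) = weightW N A (y - x) := by
      rw [weightW_eq_radialWeight, norm_sub_rev, ← weightW_eq_radialWeight]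
    rw [this]
    exact weightW_le_of_norm_sub_le hA (by simp)
  simp only [logProfile, Real.rpow_zero, mul_one]
  rw [Real.rpow_neg h1.le, Real.rpow_neg h2.le, ← div_eq_mul_inv,
    inv_le_comm₀ (by positivity) (by positivity), inv_div, div_le_iff₀ (by positivity), mul_comm,
    ← Real.mul_rpow (by positivity) h1.le]
  exact Real.rpow_le_rpow h2.le h3 (by positivity)

lemma HasDecay.bound_sub (hA : Real.exp 2 ≤ A) {F : Type*} [NormedAddCommGroup F]
    {g : EuclideanSpace ℝ (Fin N) → F} (hg : HasDecay N A g) (R : ℝ) :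
    ∃ C > 0, ∀ x, ‖x‖ ≤ R → ∀ y, ‖g (x - y)‖ ≤ C * logProfile N 0 (weightW N A y) := by
  obtain ⟨-, C, hC, h⟩ := hg
  refine ⟨C * (1 + |R|) ^ (N : ℝ), by positivity, fun x hx y => (h _).trans ?_⟩
  rw [mul_assoc]
  refine mul_le_mul_of_nonneg_left ((logProfile_sub_le hA x y).trans ?_) hC.le
  have := logProfile_pos (a := N) (b := 0) (exp_one_le_weightW hA y)
  have hR : ‖x‖ ≤ |R| := hx.trans (le_abs_self R)
  gcongr

lemma HasDecay.comp_sub_left (hA : Real.exp 2 ≤ A) {F : Type*} [NormedAddCommGroup F]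
    {g : EuclideanSpace ℝ (Fin N) → F} (hg : HasDecay N A g) (x : EuclideanSpace ℝ (Fin N)) :
    HasDecay N A fun y => g (x - y) := by
  obtain ⟨C, hC, h⟩ := hg.bound_sub hA ‖x‖
  exact ⟨hg.1.comp (continuous_const.sub continuous_id), C, hC, fun y => h x le_rfl y⟩

lemma HasDecay.comp_neg {F : Type*} [NormedAddCommGroup F]
    {g : EuclideanSpace ℝ (Fin N) → F} (hg : HasDecay N A g) :
    HasDecay N A fun y => g (-y) := by
  obtain ⟨h0, C, hC, h⟩ := hg
  refine ⟨h0.comp continuous_neg, C, hC, fun y => (h _).trans ?_⟩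
  rw [weightW_eq_radialWeight, weightW_eq_radialWeight, norm_neg]

lemma sphereArea_eq (N : ℕ) : sphereArea N =
    N * (volume : Measure (EuclideanSpace ℝ (Fin N))).real (Metric.ball 0 1) := by
  have := Measure.toSphere_real_apply_univ (volume : Measure (EuclideanSpace ℝ (Fin N)))
  rw [finrank_euclideanSpace, Fintype.card_fin] at this
  exact this

lemma sphereArea_pos (hN : 3 ≤ N) : 0 < sphereArea N := by
  rw [sphereArea_eq]
  have h : 0 < (volume : Measure (EuclideanSpace ℝ (Fin N))).real (Metric.ball 0 1) :=
    ENNReal.toReal_pos (Metric.measure_ball_pos _ _ one_pos).ne' measure_ball_lt_top.ne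
  have : (0 : ℝ) < N := by exact_mod_cast (by omega : 0 < N)
  positivity

/-- The normalising constant of the fundamental solution. -/
noncomputable def fundConst (N : ℕ) : ℝ := 1 / (((N : ℝ) - 2) * sphereArea N)

lemma fundConst_pos (hN : 3 ≤ N) : 0 < fundConst N := by
  have h1 := sphereArea_pos hN
  have h2 : (0 : ℝ) < N - 2 := by
    have : (3 : ℝ) ≤ N := by exact_mod_cast hN
    linarith
  unfold fundConst
  positivity

lemma fundSol_eq_kernelK (x : EuclideanSpace ℝ (Fin N)) :
    fundSol N x = fundConst N * kernelK N (N - 2) 0 x := by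
  simp [fundSol, kernelK, fundConst]

lemma fundSol_nonneg (hN : 3 ≤ N) (x : EuclideanSpace ℝ (Fin N)) : 0 ≤ fundSol N x := by
  rw [fundSol_eq_kernelK]
  exact mul_nonneg (fundConst_pos hN).le (kernelK_nonneg _ _ _)

lemma fundSol_neg (x : EuclideanSpace ℝ (Fin N)) : fundSol N (-x) = fundSol N x := by
  simp [fundSol]

lemma measurable_fundSol : Measurable (fundSol N) :=
  (measurable_norm.pow_const _).const_mul _

/-- `Φ` is a multiple of the kernel with `α = N - 2`, `β = 0`, and the density has the critical
exponent `N`; the third convolution regime applies because `N - 2 > 0`. -/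
lemma integrable_fundSol_sub_mul_logProfile (hA : Real.exp 2 ≤ A) (hN : 3 ≤ N) {b : ℝ}
    (hb : -1 < b) : ∃ C > 0, ∀ x : EuclideanSpace ℝ (Fin N),
      Integrable (fun y => fundSol N (x - y) * logProfile N b (weightW N A y)) ∧
      ∫ y, fundSol N (x - y) * logProfile N b (weightW N A y) ≤
        C * logProfile (N - 2) (b + 1) (weightW N A x) := by
  have hN' : (3 : ℝ) ≤ N := by exact_mod_cast hN
  have hc := fundConst_pos hN
  obtain ⟨C, hC, h⟩ := kernelK_convolution_decay (N := N) hA (by omega) (α := N - 2) (β := 0)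
    (a := N) (b := b) (c := N - 2) (d := b + 1) (by linarith) (by linarith) (by linarith)
    (Or.inr (Or.inr (Or.inl ⟨rfl, hb, Or.inl (by linarith), rfl, by ring⟩)))
  refine ⟨fundConst N * C, by positivity, fun x => ?_⟩
  have hm : Measurable fun y => kernelK N (N - 2) 0 (x - y) * logProfile N b (weightW N A y) :=
    ((measurable_kernelK _ _).comp (measurable_const.sub measurable_id)).mul
      (continuous_logProfile_weightW hA _ _).measurable
  have hnn : ∀ y, 0 ≤ kernelK N (N - 2) 0 (x - y) * logProfile N b (weightW N A y) := fun y =>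
    mul_nonneg (kernelK_nonneg _ _ _) (logProfile_pos (exp_one_le_weightW hA y)).le
  have hi : Integrable fun y => kernelK N (N - 2) 0 (x - y) * logProfile N b (weightW N A y) :=
    ⟨hm.aestronglyMeasurable, (hasFiniteIntegral_iff_ofReal (Filter.Eventually.of_forall hnn)).2
      ((h x).trans_lt ENNReal.ofReal_lt_top)⟩
  have hp := logProfile_pos (a := N - 2) (b := b + 1) (exp_one_le_weightW hA x)
  have hle : ∫ y, kernelK N (N - 2) 0 (x - y) * logProfile N b (weightW N A y) ≤
      C * logProfile (N - 2) (b + 1) (weightW N A x) := by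
    rw [integral_eq_lintegral_of_nonneg_ae (Filter.Eventually.of_forall hnn)
      hm.aestronglyMeasurable]
    exact ENNReal.toReal_le_of_le_ofReal (by positivity) (h x)
  simp only [fundSol_eq_kernelK, mul_assoc]
  refine ⟨hi.const_mul _, ?_⟩
  rw [integral_const_mul]
  exact mul_le_mul_of_nonneg_left hle hc.le

lemma integrable_fundSol_mul_logProfile (hA : Real.exp 2 ≤ A) (hN : 3 ≤ N) :
    Integrable fun y => fundSol N y * logProfile N 0 (weightW N A y) := by
  obtain ⟨C, -, h⟩ := integrable_fundSol_sub_mul_logProfile hA hN (b := 0) (by norm_num)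
  have := (h 0).1
  simpa [fundSol_neg] using this

variable {F : Type} [NormedAddCommGroup F] [NormedSpace ℝ F]

lemma HasDecay.integrable_fundSol_smul (hA : Real.exp 2 ≤ A) (hN : 3 ≤ N)
    {g : EuclideanSpace ℝ (Fin N) → F} (hg : HasDecay N A g) :
    Integrable fun y => fundSol N y • g y := by
  obtain ⟨hc, C, hC, h⟩ := hg
  refine ((integrable_fundSol_mul_logProfile hA hN).const_mul C).mono'
    (measurable_fundSol.aestronglyMeasurable.smul hc.aestronglyMeasurable)
    (Filter.Eventually.of_forall fun y => ?_)
  rw [norm_smul, Real.norm_of_nonneg (fundSol_nonneg hN y)]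
  calc _ ≤ fundSol N y * (C * logProfile N 0 (weightW N A y)) :=
        mul_le_mul_of_nonneg_left (h y) (fundSol_nonneg hN y)
    _ = _ := by ring

lemma continuous_fundSol_convolution (hA : Real.exp 2 ≤ A) (hN : 3 ≤ N)
    {g : EuclideanSpace ℝ (Fin N) → F} (hg : HasDecay N A g) :
    Continuous fun x => ∫ y, fundSol N y • g (x - y) := by
  refine continuous_iff_continuousAt.2 fun x₀ => ?_
  obtain ⟨C, hC, h⟩ := hg.bound_sub hA (‖x₀‖ + 1)
  refine continuousAt_of_dominated (bound := fun y => C *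
    (fundSol N y * logProfile N 0 (weightW N A y)))
    (Filter.Eventually.of_forall fun x =>
      ((hg.comp_sub_left hA x).integrable_fundSol_smul hA hN).aestronglyMeasurable) ?_
    ((integrable_fundSol_mul_logProfile hA hN).const_mul C)
    (Filter.Eventually.of_forall fun y => (continuous_const.smul
      (hg.1.comp (continuous_id.sub continuous_const))).continuousAt)
  filter_upwards [Metric.ball_mem_nhds x₀ one_pos] with x hx
  refine Filter.Eventually.of_forall fun y => ?_
  have hx' : ‖x‖ ≤ ‖x₀‖ + 1 := by
    have h1 : ‖x - x₀‖ < 1 := by simpa [dist_eq_norm] using hx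
    have h2 := norm_add_le x₀ (x - x₀)
    rw [add_sub_cancel] at h2
    linarith
  rw [norm_smul, Real.norm_of_nonneg (fundSol_nonneg hN y)]
  calc _ ≤ fundSol N y * (C * logProfile N 0 (weightW N A y)) :=
        mul_le_mul_of_nonneg_left (h x hx' y) (fundSol_nonneg hN y)
    _ = _ := by ring

/-- Derivatives fall on the smooth factor `g`, never on the singular `Φ`. -/
lemma hasFDerivAt_fundSol_convolution (hA : Real.exp 2 ≤ A) (hN : 3 ≤ N)
    {g : EuclideanSpace ℝ (Fin N) → F} (hg : HasDecay N A g) (hd : Differentiable ℝ g)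
    (hg' : HasDecay N A (fderiv ℝ g)) (x₀ : EuclideanSpace ℝ (Fin N)) :
    HasFDerivAt (fun x => ∫ y, fundSol N y • g (x - y))
      (∫ y, fundSol N y • fderiv ℝ g (x₀ - y)) x₀ := by
  obtain ⟨C, hC, h⟩ := hg'.bound_sub hA (‖x₀‖ + 1)
  refine hasFDerivAt_integral_of_dominated_of_fderiv_le
    (F' := fun x y => fundSol N y • fderiv ℝ g (x - y)) (bound := fun y => C *
    (fundSol N y * logProfile N 0 (weightW N A y))) (Metric.ball_mem_nhds x₀ one_pos)
    (Filter.Eventually.of_forall fun x =>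
      ((hg.comp_sub_left hA x).integrable_fundSol_smul hA hN).aestronglyMeasurable)
    ((hg.comp_sub_left hA x₀).integrable_fundSol_smul hA hN)
    ((hg'.comp_sub_left hA x₀).integrable_fundSol_smul hA hN).aestronglyMeasurable
    (Filter.Eventually.of_forall fun y x hx => ?_)
    ((integrable_fundSol_mul_logProfile hA hN).const_mul C)
    (Filter.Eventually.of_forall fun y x _ => ?_)
  · have hx' : ‖x‖ ≤ ‖x₀‖ + 1 := by
      have h1 : ‖x - x₀‖ < 1 := by simpa [dist_eq_norm] using hx
      have h2 := norm_add_le x₀ (x - x₀)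
      rw [add_sub_cancel] at h2
      linarith
    rw [norm_smul, Real.norm_of_nonneg (fundSol_nonneg hN y)]
    calc _ ≤ fundSol N y * (C * logProfile N 0 (weightW N A y)) :=
          mul_le_mul_of_nonneg_left (h x hx' y) (fundSol_nonneg hN y)
      _ = _ := by ring
  · have h1 : HasFDerivAt (fun x => g (x - y)) (fderiv ℝ g (x - y)) x := by
      have := (hd (x - y)).hasFDerivAt.comp x ((hasFDerivAt_id x).sub_const y)
      rw [ContinuousLinearMap.comp_id] at this
      exact this
    exact h1.const_smul (fundSol N y)

lemma hasDecay_of_iteratedFDeriv {n : ℕ} {g : EuclideanSpace ℝ (Fin N) → F} (hc : ContDiff ℝ n g)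
    (h : ∀ k ≤ n, HasDecay N A (iteratedFDeriv ℝ k g)) : HasDecay N A g := by
  obtain ⟨-, C, hC, hb⟩ := h 0 (Nat.zero_le n)
  exact ⟨hc.continuous, C, hC, fun x => by simpa using hb x⟩

lemma hasDecay_iteratedFDeriv_fderiv {n : ℕ} {g : EuclideanSpace ℝ (Fin N) → F}
    (hc : ContDiff ℝ (n + 1 : ℕ) g)
    (h : ∀ k ≤ n + 1, HasDecay N A (iteratedFDeriv ℝ k g)) (k : ℕ) (hk : k ≤ n) :
    HasDecay N A (iteratedFDeriv ℝ k (fderiv ℝ g)) := by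
  obtain ⟨-, C, hC, hb⟩ := h (k + 1) (by omega)
  have h1 : ContDiff ℝ n (fderiv ℝ g) := hc.fderiv_right (by norm_cast)
  exact ⟨h1.continuous_iteratedFDeriv (by exact_mod_cast hk), C, hC, fun x => by
    rw [norm_iteratedFDeriv_fderiv]; exact hb x⟩

/-- The target space is quantified inside the induction, because the inductive step passes from `g`
to `fderiv ℝ g`, which has values in another space. -/
theorem contDiff_fundSol_convolution (hA : Real.exp 2 ≤ A) (hN : 3 ≤ N) (n : ℕ) :
    ∀ {F : Type} [NormedAddCommGroup F] [NormedSpace ℝ F] {g : EuclideanSpace ℝ (Fin N) → F},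
      ContDiff ℝ n g → (∀ k ≤ n, HasDecay N A (iteratedFDeriv ℝ k g)) →
      ContDiff ℝ n fun x => ∫ y, fundSol N y • g (x - y) := by
  induction n with
  | zero =>
    intro F _ _ g hc h
    exact contDiff_zero.2 (continuous_fundSol_convolution hA hN (hasDecay_of_iteratedFDeriv hc h))
  | succ n ih =>
    intro F _ _ g hc h
    have hc' : ContDiff ℝ n (fderiv ℝ g) := hc.fderiv_right (by norm_cast)
    have h' := hasDecay_iteratedFDeriv_fderiv hc h
    push_cast
    refine contDiff_succ_iff_hasFDerivAt.2 ⟨_, ih hc' h', fun x => ?_⟩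
    exact hasFDerivAt_fundSol_convolution hA hN (hasDecay_of_iteratedFDeriv hc h)
      (hc.differentiable (by simp)) (hasDecay_of_iteratedFDeriv hc' h') x

lemma laplacian_eq_sum_fderiv (f : EuclideanSpace ℝ (Fin N) → ℝ) (x : EuclideanSpace ℝ (Fin N)) :
    Δ f x = ∑ i, fderiv ℝ (fderiv ℝ f) x (EuclideanSpace.basisFun (Fin N) ℝ i)
      (EuclideanSpace.basisFun (Fin N) ℝ i) := by
  rw [InnerProductSpace.laplacian_eq_iteratedFDeriv_orthonormalBasis f
    (EuclideanSpace.basisFun (Fin N) ℝ)]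
  simp only [iteratedFDeriv_two_apply, Matrix.cons_val_zero, Matrix.cons_val_one]

theorem laplacian_fundSol_convolution (hA : Real.exp 2 ≤ A) (hN : 3 ≤ N)
    {g : EuclideanSpace ℝ (Fin N) → ℝ} (hc : ContDiff ℝ 2 g)
    (h : ∀ k ≤ 2, HasDecay N A (iteratedFDeriv ℝ k g)) (x : EuclideanSpace ℝ (Fin N)) :
    Δ (fun x => ∫ y, fundSol N y • g (x - y)) x = ∫ y, fundSol N y * Δ g (x - y) := by
  have hc1 : ContDiff ℝ 1 (fderiv ℝ g) := hc.fderiv_right (by norm_num)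
  have hc2 : ContDiff ℝ 0 (fderiv ℝ (fderiv ℝ g)) := hc1.fderiv_right (by norm_num)
  have h1 := hasDecay_iteratedFDeriv_fderiv (n := 1) hc h
  have h2 := hasDecay_iteratedFDeriv_fderiv (n := 0) hc1 h1
  have d0 := hasDecay_of_iteratedFDeriv (n := 2) hc h
  have d1 := hasDecay_of_iteratedFDeriv (n := 1) hc1 h1
  have d2 := hasDecay_of_iteratedFDeriv (n := 0) hc2 h2
  have e1 : fderiv ℝ (fun x => ∫ y, fundSol N y • g (x - y)) =
      fun x => ∫ y, fundSol N y • fderiv ℝ g (x - y) := funext fun x =>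
    (hasFDerivAt_fundSol_convolution hA hN d0 (hc.differentiable (by norm_num)) d1 x).fderiv
  have e2 : fderiv ℝ (fun x => ∫ y, fundSol N y • fderiv ℝ g (x - y)) x =
      ∫ y, fundSol N y • fderiv ℝ (fderiv ℝ g) (x - y) :=
    (hasFDerivAt_fundSol_convolution hA hN d1 (hc1.differentiable (by norm_num)) d2 x).fderiv
  have hi := (d2.comp_sub_left hA x).integrable_fundSol_smul hA hN
  have hi' : ∀ i, Integrable fun y => fundSol N y * fderiv ℝ (fderiv ℝ g) (x - y)
      (EuclideanSpace.basisFun (Fin N) ℝ i) (EuclideanSpace.basisFun (Fin N) ℝ i) := fun i =>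
    (hi.apply_continuousLinearMap _).apply_continuousLinearMap _
  simp only [laplacian_eq_sum_fderiv]
  rw [e1, e2]
  simp only [Finset.mul_sum]
  rw [integral_finsetSum _ fun i _ => hi' i]
  refine Finset.sum_congr rfl fun i _ => ?_
  rw [ContinuousLinearMap.integral_apply hi,
    ContinuousLinearMap.integral_apply (hi.apply_continuousLinearMap _)]
  rfl

end Potential

/-! ### The identity `∫ Φ Δg = -g(0)` by regularisation. -/

section Newton

open Set Topology Filter

variable {N : ℕ} {A : ℝ}

/-- The regularised power `(s + |y|²)^e`. -/
noncomputable def regPow (N : ℕ) (s e : ℝ) (y : EuclideanSpace ℝ (Fin N)) : ℝ :=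
  (s + ‖y‖ ^ 2) ^ e

lemma regPow_base_pos {s : ℝ} (hs : 0 < s) (y : EuclideanSpace ℝ (Fin N)) : 0 < s + ‖y‖ ^ 2 := by
  positivity

lemma regPow_pos {s : ℝ} (hs : 0 < s) (e : ℝ) (y : EuclideanSpace ℝ (Fin N)) :
    0 < regPow N s e y := Real.rpow_pos_of_pos (regPow_base_pos hs y) _

lemma hasFDerivAt_regPow {s : ℝ} (hs : 0 < s) (e : ℝ) (y : EuclideanSpace ℝ (Fin N)) :
    HasFDerivAt (regPow N s e) ((2 * e * regPow N s (e - 1) y) • innerSL ℝ y) y := by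
  have h := ((hasStrictFDerivAt_norm_sq y).hasFDerivAt.const_add s).rpow_const (p := e)
    (Or.inl (regPow_base_pos hs y).ne')
  refine h.congr_fderiv ?_
  ext z
  simp [regPow]
  ring

lemma continuous_regPow {s : ℝ} (hs : 0 < s) (e : ℝ) : Continuous (regPow N s e) :=
  continuous_iff_continuousAt.2 fun y => (hasFDerivAt_regPow hs e y).continuousAt

lemma hasFDerivAt_coord (i : Fin N) (y : EuclideanSpace ℝ (Fin N)) :
    HasFDerivAt (fun y : EuclideanSpace ℝ (Fin N) => y i)
      (EuclideanSpace.proj i : EuclideanSpace ℝ (Fin N) →L[ℝ] ℝ) y :=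
  (EuclideanSpace.proj i : EuclideanSpace ℝ (Fin N) →L[ℝ] ℝ).hasFDerivAt

lemma hasLineDerivAt_regPow {s : ℝ} (hs : 0 < s) (e : ℝ) (i : Fin N)
    (y : EuclideanSpace ℝ (Fin N)) :
    HasLineDerivAt ℝ (regPow N s e) (2 * e * regPow N s (e - 1) y * y i) y
      (EuclideanSpace.basisFun (Fin N) ℝ i) := by
  have h := (hasFDerivAt_regPow hs e y).hasLineDerivAt (EuclideanSpace.basisFun (Fin N) ℝ i)
  simpa [EuclideanSpace.inner_single_right] using h

lemma hasLineDerivAt_regPow_mul_coord {s : ℝ} (hs : 0 < s) (e : ℝ) (i : Fin N)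
    (y : EuclideanSpace ℝ (Fin N)) :
    HasLineDerivAt ℝ (fun y => 2 * e * regPow N s (e - 1) y * y i)
      (2 * e * regPow N s (e - 1) y + 4 * e * (e - 1) * regPow N s (e - 2) y * y i ^ 2) y
      (EuclideanSpace.basisFun (Fin N) ℝ i) := by
  have h := ((((hasFDerivAt_regPow hs (e - 1) y).const_mul (2 * e)).mul
    (hasFDerivAt_coord i y)).hasLineDerivAt (EuclideanSpace.basisFun (Fin N) ℝ i))
  have e1 : e - 1 - 1 = e - 2 := by ring
  refine HasDerivAt.congr_deriv h ?_
  simp [EuclideanSpace.inner_single_right, e1]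
  ring

lemma regPow_sub_one {s : ℝ} (hs : 0 < s) (e : ℝ) (y : EuclideanSpace ℝ (Fin N)) :
    regPow N s (e - 1) y = regPow N s e y / (s + ‖y‖ ^ 2) :=
  Real.rpow_sub_one (regPow_base_pos hs y).ne' e

/-- For this exponent `2(e - 1) = -N`, so the `‖y‖²` terms cancel and only a bubble proportional to
`s` remains, reflecting that `Φ` is harmonic off the origin. -/
lemma sum_second_deriv_regPow {s : ℝ} (hs : 0 < s) (y : EuclideanSpace ℝ (Fin N)) {e : ℝ}
    (he : e = (2 - N) / 2) :
    ∑ i, (2 * e * regPow N s (e - 1) y + 4 * e * (e - 1) * regPow N s (e - 2) y * y i ^ 2) =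
      -(N * (N - 2) * s * regPow N s (-(N + 2) / 2) y) := by
  have hT := regPow_base_pos hs y
  have h1 : regPow N s (e - 1) y = regPow N s (e - 2) y * (s + ‖y‖ ^ 2) := by
    rw [show e - 2 = e - 1 - 1 by ring, regPow_sub_one hs (e - 1)]
    field_simp
  have h2 : ‖y‖ ^ 2 = ∑ i, y i ^ 2 := EuclideanSpace.real_norm_sq_eq y
  have h3 : e - 2 = -(N + 2) / 2 := by rw [he]; ring
  rw [Finset.sum_add_distrib, ← Finset.mul_sum Finset.univ (fun i => y i ^ 2), ← h2,
    Finset.sum_const, Finset.card_univ,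
    Fintype.card_fin, nsmul_eq_mul, h1, h3, he]
  ring

lemma norm_coord_le (y : EuclideanSpace ℝ (Fin N)) (i : Fin N) : |y i| ≤ ‖y‖ := by
  simpa using PiLp.norm_apply_le y i

lemma abs_deriv_regPow_le {s : ℝ} (hs : 0 < s) (e : ℝ) (i : Fin N)
    (y : EuclideanSpace ℝ (Fin N)) :
    |2 * e * regPow N s (e - 1) y * y i| ≤ (|2 * e| * (1 + 1 / s)) * regPow N s e y := by
  have hT := regPow_base_pos hs y
  have hp := regPow_pos hs e y
  have h1 : |y i| ≤ (1 + 1 / s) * (s + ‖y‖ ^ 2) := by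
    have h2 := norm_coord_le y i
    have h3 : 0 ≤ 1 / s * ‖y‖ ^ 2 := by positivity
    have h4 : (1 + 1 / s) * (s + ‖y‖ ^ 2) = s + ‖y‖ ^ 2 + 1 + 1 / s * ‖y‖ ^ 2 := by
      field_simp
      ring
    nlinarith [sq_nonneg (‖y‖ - 1)]
  rw [regPow_sub_one hs, abs_mul, abs_mul, abs_div, abs_of_pos hp, abs_of_pos hT]
  calc |2 * e| * (regPow N s e y / (s + ‖y‖ ^ 2)) * |y i|
      ≤ |2 * e| * (regPow N s e y / (s + ‖y‖ ^ 2)) * ((1 + 1 / s) * (s + ‖y‖ ^ 2)) := by gcongr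
    _ = _ := by field_simp

lemma abs_second_deriv_regPow_le {s : ℝ} (hs : 0 < s) (e : ℝ) (i : Fin N)
    (y : EuclideanSpace ℝ (Fin N)) :
    |2 * e * regPow N s (e - 1) y + 4 * e * (e - 1) * regPow N s (e - 2) y * y i ^ 2| ≤
      ((|2 * e| + |4 * e * (e - 1)|) * (1 / s)) * regPow N s e y := by
  have hT := regPow_base_pos hs y
  have hp := regPow_pos hs e y
  have hb : regPow N s (e - 1) y ≤ 1 / s * regPow N s e y := by
    rw [regPow_sub_one hs, div_eq_inv_mul, one_div]
    gcongr
    nlinarith [sq_nonneg ‖y‖]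
  have hp1 := regPow_pos hs (e - 1) y
  have h2 : regPow N s (e - 2) y * y i ^ 2 ≤ regPow N s (e - 1) y := by
    rw [show e - 2 = e - 1 - 1 by ring, regPow_sub_one hs (e - 1), div_mul_eq_mul_div,
      div_le_iff₀ hT]
    gcongr
    have := norm_coord_le y i
    rw [← sq_abs]
    nlinarith [abs_nonneg (y i)]
  have hp2 := regPow_pos hs (e - 2) y
  calc _ ≤ |2 * e| * regPow N s (e - 1) y +
        |4 * e * (e - 1)| * (regPow N s (e - 2) y * y i ^ 2) := by
        refine (abs_add_le _ _).trans ?_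
        rw [abs_mul (2 * e), abs_of_pos hp1, mul_assoc _ (regPow N s (e - 2) y),
          abs_mul (4 * e * (e - 1)), abs_of_nonneg (by positivity : 0 ≤ regPow N s (e - 2) y * y i ^ 2)]
    _ ≤ |2 * e| * (1 / s * regPow N s e y) + |4 * e * (e - 1)| * (1 / s * regPow N s e y) := by
        exact add_le_add (mul_le_mul_of_nonneg_left hb (abs_nonneg _))
          (mul_le_mul_of_nonneg_left (h2.trans hb) (abs_nonneg _))
    _ = _ := by ring

lemma fundConst_mul_regPow_le (hN : 3 ≤ N) {s : ℝ} (hs : 0 < s) {y : EuclideanSpace ℝ (Fin N)}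
    (hy : y ≠ 0) : fundConst N * regPow N s ((2 - N) / 2) y ≤ fundSol N y := by
  have hN' : (3 : ℝ) ≤ N := by exact_mod_cast hN
  have hy' : 0 < ‖y‖ := norm_pos_iff.2 hy
  have e : ‖y‖ ^ (-((N : ℝ) - 2)) = (‖y‖ ^ 2) ^ ((2 - (N : ℝ)) / 2) := by
    rw [← Real.rpow_natCast, ← Real.rpow_mul hy'.le]
    congr 1
    push_cast
    ring
  rw [fundSol, e]
  exact mul_le_mul_of_nonneg_left (Real.rpow_le_rpow_of_nonpos (by positivity) (by linarith)
    (by linarith)) (fundConst_pos hN).le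

lemma ae_ne_zero (hN : 3 ≤ N) : ∀ᵐ y : EuclideanSpace ℝ (Fin N), y ≠ 0 := by
  have : Nontrivial (EuclideanSpace ℝ (Fin N)) :=
    Module.nontrivial_of_finrank_pos (R := ℝ) (by simp; omega)
  exact Measure.ae_ne volume 0

/-- The regularised power and its first two derivatives are bounded by multiples of the power
itself, hence by `Φ`. All products in the integration by parts are therefore integrable, and no
boundary terms arise. -/
lemma integrable_mul_of_le_regPow (hA : Real.exp 2 ≤ A) (hN : 3 ≤ N) {s : ℝ} (hs : 0 < s)
    {H h : EuclideanSpace ℝ (Fin N) → ℝ} (hH : Continuous H) {C : ℝ} (hC : 0 ≤ C)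
    (hb : ∀ y, |H y| ≤ C * regPow N s ((2 - N) / 2) y) (hh : HasDecay N A h) :
    Integrable fun y => H y * h y := by
  have hc := fundConst_pos hN
  refine ((hh.integrable_fundSol_smul hA hN).norm.const_mul (C / fundConst N)).mono'
    (hH.mul hh.1).aestronglyMeasurable ?_
  filter_upwards [ae_ne_zero hN] with y hy
  rw [norm_mul, norm_smul, Real.norm_of_nonneg (fundSol_nonneg hN y), ← mul_assoc]
  refine mul_le_mul_of_nonneg_right ((hb y).trans ?_) (norm_nonneg _)
  rw [div_mul_eq_mul_div, le_div_iff₀ hc]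
  calc _ = C * (fundConst N * regPow N s ((2 - N) / 2) y) := by ring
    _ ≤ _ := mul_le_mul_of_nonneg_left (fundConst_mul_regPow_le hN hs hy) hC

lemma HasDecay.apply {F : Type} [NormedAddCommGroup F] [NormedSpace ℝ F]
    {g : EuclideanSpace ℝ (Fin N) → EuclideanSpace ℝ (Fin N) →L[ℝ] F} (hg : HasDecay N A g)
    (i : Fin N) : HasDecay N A fun y => g y (EuclideanSpace.basisFun (Fin N) ℝ i) := by
  obtain ⟨hc, C, hC, h⟩ := hg
  refine ⟨hc.clm_apply continuous_const, C, hC, fun x => le_trans ?_ (h x)⟩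
  simpa using (g x).le_opNorm (EuclideanSpace.basisFun (Fin N) ℝ i)

/-- Green's identity for the regularised fundamental solution. -/
lemma integral_regPow_mul_laplacian (hA : Real.exp 2 ≤ A) (hN : 3 ≤ N) {s : ℝ} (hs : 0 < s)
    {g : EuclideanSpace ℝ (Fin N) → ℝ} (hc : ContDiff ℝ 2 g)
    (h : ∀ k ≤ 2, HasDecay N A (iteratedFDeriv ℝ k g)) :
    ∫ y, regPow N s ((2 - N) / 2) y * Δ g y =
      -∫ y, N * (N - 2) * s * regPow N s (-(N + 2) / 2) y * g y := by
  have hc1 : ContDiff ℝ 1 (fderiv ℝ g) := hc.fderiv_right (by norm_num)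
  have hc2 : ContDiff ℝ 0 (fderiv ℝ (fderiv ℝ g)) := hc1.fderiv_right (by norm_num)
  have h1 := hasDecay_iteratedFDeriv_fderiv (n := 1) hc h
  have h2 := hasDecay_iteratedFDeriv_fderiv (n := 0) hc1 h1
  have d0 := hasDecay_of_iteratedFDeriv (n := 2) hc h
  have d1 := hasDecay_of_iteratedFDeriv (n := 1) hc1 h1
  have d2 := hasDecay_of_iteratedFDeriv (n := 0) hc2 h2
  set e : ℝ := (2 - N) / 2 with he
  set b := EuclideanSpace.basisFun (Fin N) ℝ with hb
  set G : Fin N → EuclideanSpace ℝ (Fin N) → ℝ := fun i y => 2 * e * regPow N s (e - 1) y * y i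
    with hG
  set K : Fin N → EuclideanSpace ℝ (Fin N) → ℝ := fun i y =>
    2 * e * regPow N s (e - 1) y + 4 * e * (e - 1) * regPow N s (e - 2) y * y i ^ 2 with hK
  have cF : Continuous (regPow N s e) := continuous_regPow hs e
  have cG : ∀ i, Continuous (G i) := fun i => by
    have := continuous_regPow (N := N) hs (e - 1)
    fun_prop
  have cK : ∀ i, Continuous (K i) := fun i => by
    have := continuous_regPow (N := N) hs (e - 1)
    have := continuous_regPow (N := N) hs (e - 2)
    fun_prop
  have bF : ∀ y, |regPow N s e y| ≤ 1 * regPow N s e y := fun y => by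
    rw [abs_of_pos (regPow_pos hs e y), one_mul]
  have bG : ∀ i y, |G i y| ≤ _ := fun i y => abs_deriv_regPow_le hs e i y
  have bK : ∀ i y, |K i y| ≤ _ := fun i y => abs_second_deriv_regPow_le hs e i y
  have iF := fun {w : EuclideanSpace ℝ (Fin N) → ℝ} (hw : HasDecay N A w) =>
    integrable_mul_of_le_regPow hA hN hs cF zero_le_one bF hw
  have iG := fun (i : Fin N) {w : EuclideanSpace ℝ (Fin N) → ℝ} (hw : HasDecay N A w) =>
    integrable_mul_of_le_regPow hA hN hs (cG i) (by positivity) (bG i) hw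
  have iK := fun (i : Fin N) {w : EuclideanSpace ℝ (Fin N) → ℝ} (hw : HasDecay N A w) =>
    integrable_mul_of_le_regPow hA hN hs (cK i) (by positivity) (bK i) hw
  have l0 : ∀ i y, HasLineDerivAt ℝ g (fderiv ℝ g y (b i)) y (b i) := fun i y =>
    (hc.differentiable (by norm_num) y).hasFDerivAt.hasLineDerivAt _
  have l1 : ∀ i y, HasLineDerivAt ℝ (fun y => fderiv ℝ g y (b i))
      (fderiv ℝ (fderiv ℝ g) y (b i) (b i)) y (b i) := fun i y => by
    have := ((hc1.differentiable (by norm_num) y).hasFDerivAt.clm_apply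
      (hasFDerivAt_const (b i) y)).hasLineDerivAt (b i)
    simpa using this
  have ibp : ∀ i, ∫ y, regPow N s e y * fderiv ℝ (fderiv ℝ g) y (b i) (b i) =
      ∫ y, K i y * g y := fun i => by
    have s1 := integral_bilinear_hasLineDerivAt_right_eq_neg_left_of_integrable
      (μ := (volume : Measure (EuclideanSpace ℝ (Fin N)))) (B := ContinuousLinearMap.mul ℝ ℝ)
      (f := regPow N s e) (f' := G i) (g := fun y => fderiv ℝ g y (b i))
      (g' := fun y => fderiv ℝ (fderiv ℝ g) y (b i) (b i)) (v := b i)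
      (iG i (d1.apply i)) (iF ((d2.apply i).apply i)) (iF (d1.apply i))
      (fun y _ => hasLineDerivAt_regPow hs e i y) (fun y _ => l1 i y)
    have s2 := integral_bilinear_hasLineDerivAt_right_eq_neg_left_of_integrable
      (μ := (volume : Measure (EuclideanSpace ℝ (Fin N)))) (B := ContinuousLinearMap.mul ℝ ℝ)
      (f := G i) (f' := K i) (g := g) (g' := fun y => fderiv ℝ g y (b i)) (v := b i)
      (iK i d0) (iG i (d1.apply i)) (iG i d0)
      (fun y _ => hasLineDerivAt_regPow_mul_coord hs e i y) (fun y _ => l0 i y)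
    simp only [ContinuousLinearMap.mul_apply'] at s1 s2
    rw [s1, s2, neg_neg]
  simp only [laplacian_eq_sum_fderiv, Finset.mul_sum]
  rw [integral_finsetSum _ fun i _ => iF ((d2.apply i).apply i), ← integral_neg,
    Finset.sum_congr rfl fun i _ => ibp i, ← integral_finsetSum _ fun i _ => iK i d0]
  refine integral_congr_ae (Eventually.of_forall fun y => ?_)
  simp only
  rw [← Finset.sum_mul, hK, sum_second_deriv_regPow hs y he]
  ring

/-- The primitive is `(r²/(1+r²))^{N/2} / N`, written so that its limit at infinity is visible. -/
lemma hasDerivAt_bubble_mass (hN : 3 ≤ N) {r : ℝ} (hr : 0 ≤ r) :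
    HasDerivAt (fun r : ℝ => (1 - (1 + r ^ 2)⁻¹) ^ ((N : ℝ) / 2) / (N : ℝ))
      (r ^ (N - 1) * (1 + r ^ 2) ^ (-((N : ℝ) + 2) / 2)) r := by
  have hN' : (3 : ℝ) ≤ N := by exact_mod_cast hN
  have hT : 0 < 1 + r ^ 2 := by positivity
  have h1 : HasDerivAt (fun r : ℝ => 1 + r ^ 2) (2 * r) r := by
    simpa using ((hasDerivAt_id r).pow 2).const_add 1
  have h2 := (((h1.inv hT.ne').const_sub 1).rpow_const (p := (N : ℝ) / 2)
    (Or.inr (by linarith))).div_const (N : ℝ)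
  refine h2.congr_deriv ?_
  have e1 : 1 - (1 + r ^ 2)⁻¹ = r ^ 2 * (1 + r ^ 2)⁻¹ := by field_simp; ring
  have e2 : (r ^ 2) ^ ((N : ℝ) / 2 - 1) = r ^ (N - 2) := by
    rw [← Real.rpow_natCast, ← Real.rpow_natCast, ← Real.rpow_mul hr, Nat.cast_sub (by omega)]
    congr 1
    push_cast
    ring
  have e3 : (1 + r ^ 2) ^ (-((N : ℝ) + 2) / 2) =
      (1 + r ^ 2)⁻¹ ^ ((N : ℝ) / 2 - 1) * ((1 + r ^ 2) ^ 2)⁻¹ := by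
    rw [Real.inv_rpow hT.le, ← Real.rpow_neg hT.le, ← Real.rpow_natCast (1 + r ^ 2) 2,
      ← Real.rpow_neg hT.le, ← Real.rpow_add hT]
    congr 1
    push_cast
    ring
  have e4 : r ^ (N - 1) = r * r ^ (N - 2) := by
    rw [← pow_succ']
    congr 1
    omega
  simp only [Pi.inv_apply]
  rw [e1, Real.mul_rpow (by positivity) (by positivity), e2, e3, e4]
  field_simp

lemma integral_bubble (hN : 3 ≤ N) :
    ∫ y : EuclideanSpace ℝ (Fin N), regPow N 1 (-(N + 2) / 2) y = sphereArea N / N := by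
  have : Nontrivial (EuclideanSpace ℝ (Fin N)) :=
    Module.nontrivial_of_finrank_pos (R := ℝ) (by simp; omega)
  have hN' : (3 : ℝ) ≤ N := by exact_mod_cast hN
  have h := integral_fun_norm_addHaar (volume : Measure (EuclideanSpace ℝ (Fin N)))
    fun r => (1 + r ^ 2) ^ (-((N : ℝ) + 2) / 2)
  simp only [finrank_euclideanSpace, Fintype.card_fin, nsmul_eq_mul, smul_eq_mul] at h
  have ht : Tendsto (fun r : ℝ => (1 - (1 + r ^ 2)⁻¹) ^ ((N : ℝ) / 2) / (N : ℝ)) atTop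
      (𝓝 (1 / (N : ℝ))) := by
    have t1 : Tendsto (fun r : ℝ => 1 + r ^ 2) atTop atTop :=
      tendsto_atTop_add_const_left _ _ (tendsto_pow_atTop (by norm_num))
    have t2 := ((t1.inv_tendsto_atTop.const_sub 1).rpow_const (p := (N : ℝ) / 2)
      (Or.inl (by norm_num))).div_const (N : ℝ)
    simpa using t2
  have hI := integral_Ioi_of_hasDerivAt_of_nonneg' (a := 0)
    (fun r hr => hasDerivAt_bubble_mass hN (mem_Ici.1 hr))
    (fun r hr => by have : 0 < r := hr; positivity) ht
  have h0 : (1 - (1 + (0 : ℝ) ^ 2)⁻¹) ^ ((N : ℝ) / 2) / (N : ℝ) = 0 := by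
    norm_num
    left
    exact Real.zero_rpow (by linarith)
  rw [hI, h0, sub_zero, ← mul_assoc, ← sphereArea_eq, mul_one_div] at h
  exact h

/-- With `s = ε²` the substitution `y ↦ εy` shows that the bubbles have constant mass and
concentrate at the origin. -/
lemma integral_scaled_bubble {g : EuclideanSpace ℝ (Fin N) → ℝ} {ε : ℝ} (hε : 0 < ε) :
    ∫ y, N * (N - 2) * ε ^ 2 * regPow N (ε ^ 2) (-(N + 2) / 2) y * g y =
      N * (N - 2) * ∫ y, regPow N 1 (-(N + 2) / 2) y * g (ε • y) := by
  have h := Measure.integral_comp_smul (volume : Measure (EuclideanSpace ℝ (Fin N)))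
    (fun y => N * (N - 2) * ε ^ 2 * regPow N (ε ^ 2) (-(N + 2) / 2) y * g y) ε
  rw [finrank_euclideanSpace, Fintype.card_fin, abs_of_pos (by positivity), smul_eq_mul] at h
  rw [← integral_const_mul]
  have e : ∀ y : EuclideanSpace ℝ (Fin N),
      N * (N - 2) * ε ^ 2 * regPow N (ε ^ 2) (-(N + 2) / 2) (ε • y) * g (ε • y) =
      (ε ^ N)⁻¹ * (N * (N - 2) * (regPow N 1 (-(N + 2) / 2) y * g (ε • y))) := fun y => by
    have e1 : ε ^ 2 + ‖ε • y‖ ^ 2 = ε ^ 2 * (1 + ‖y‖ ^ 2) := by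
      rw [norm_smul, Real.norm_of_nonneg hε.le]; ring
    have e2 : (ε ^ 2) ^ (-((N : ℝ) + 2) / 2) = (ε ^ N)⁻¹ * (ε ^ 2)⁻¹ := by
      rw [← Real.rpow_natCast, ← Real.rpow_natCast, ← Real.rpow_mul hε.le, ← Real.rpow_neg hε.le,
        ← Real.rpow_neg hε.le, ← Real.rpow_add hε]
      congr 1
      push_cast
      ring
    rw [regPow, e1, Real.mul_rpow (by positivity) (by positivity), e2, regPow]
    field_simp
  simp_rw [e] at h
  rw [integral_const_mul] at h
  exact (mul_left_cancel₀ (by positivity) h).symm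

/-- The Newtonian potential inverts the Laplacian. -/
theorem integral_fundSol_mul_laplacian (hA : Real.exp 2 ≤ A) (hN : 3 ≤ N)
    {g : EuclideanSpace ℝ (Fin N) → ℝ} (hc : ContDiff ℝ 2 g)
    (h : ∀ k ≤ 2, HasDecay N A (iteratedFDeriv ℝ k g)) :
    ∫ y, fundSol N y * Δ g y = -g 0 := by
  have hN' : (3 : ℝ) ≤ N := by exact_mod_cast hN
  have hcN := fundConst_pos hN
  have d0 := hasDecay_of_iteratedFDeriv (n := 2) hc h
  have hΔ : HasDecay N A (Δ g) := by
    have hc1 : ContDiff ℝ 1 (fderiv ℝ g) := hc.fderiv_right (by norm_num)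
    have hc2 : ContDiff ℝ 0 (fderiv ℝ (fderiv ℝ g)) := hc1.fderiv_right (by norm_num)
    have d2 := hasDecay_of_iteratedFDeriv (n := 0) hc2
      (hasDecay_iteratedFDeriv_fderiv (n := 0) hc1 (hasDecay_iteratedFDeriv_fderiv (n := 1) hc h))
    have e : Δ g = fun x => ∑ i, fderiv ℝ (fderiv ℝ g) x (EuclideanSpace.basisFun (Fin N) ℝ i)
        (EuclideanSpace.basisFun (Fin N) ℝ i) := funext (laplacian_eq_sum_fderiv g)
    rw [e]
    choose hci C hC hb using fun i => (d2.apply i).apply i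
    refine ⟨continuous_finsetSum _ fun i _ => hci i, ∑ i, C i + 1, ?_, fun x => ?_⟩
    · have := Finset.sum_nonneg fun i (_ : i ∈ Finset.univ) => (hC i).le
      linarith
    · have hp := logProfile_pos (a := N) (b := 0) (exp_one_le_weightW hA x)
      refine (norm_sum_le _ _).trans ((Finset.sum_le_sum fun i _ => hb i x).trans ?_)
      rw [← Finset.sum_mul]
      nlinarith
  set ε : ℕ → ℝ := fun n => 1 / ((n : ℝ) + 1) with hε
  have hε0 : ∀ n, 0 < ε n := fun n => by positivity
  have hεt : Tendsto ε atTop (𝓝 0) := tendsto_one_div_add_atTop_nhds_zero_nat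
  have key : ∀ n, ∫ y, fundConst N * regPow N (ε n ^ 2) ((2 - N) / 2) y * Δ g y =
      -(fundConst N * (N * (N - 2) * ∫ y, regPow N 1 (-(N + 2) / 2) y * g (ε n • y))) := fun n => by
    simp_rw [mul_assoc (fundConst N)]
    rw [integral_const_mul,
      integral_regPow_mul_laplacian hA hN (pow_pos (hε0 n) 2) hc h,
      integral_scaled_bubble (hε0 n), mul_neg]
  -- The regularisations lie below `Φ` off the origin, so `|Φ Δg|` dominates.
  have lim1 : Tendsto (fun n => ∫ y, fundConst N * regPow N (ε n ^ 2) ((2 - N) / 2) y * Δ g y)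
      atTop (𝓝 (∫ y, fundSol N y * Δ g y)) := by
    refine tendsto_integral_of_dominated_convergence (fun y => ‖fundSol N y • Δ g y‖)
      (fun n => (((continuous_regPow (pow_pos (hε0 n) 2) _).const_mul _).mul
        hΔ.1).aestronglyMeasurable) (hΔ.integrable_fundSol_smul hA hN).norm (fun n => ?_) ?_
    · filter_upwards [ae_ne_zero hN] with y hy
      have := regPow_pos (pow_pos (hε0 n) 2) ((2 - N) / 2) y
      rw [norm_mul, norm_smul, Real.norm_of_nonneg (by positivity),
        Real.norm_of_nonneg (fundSol_nonneg hN y)]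
      exact mul_le_mul_of_nonneg_right (fundConst_mul_regPow_le hN (pow_pos (hε0 n) 2) hy)
        (norm_nonneg _)
    · filter_upwards [ae_ne_zero hN] with y hy
      have hy' : 0 < ‖y‖ := norm_pos_iff.2 hy
      refine Tendsto.mul_const _ (Tendsto.const_mul _ ?_)
      have t1 : Tendsto (fun n => ε n ^ 2 + ‖y‖ ^ 2) atTop (𝓝 (0 ^ 2 + ‖y‖ ^ 2)) :=
        (hεt.pow 2).add_const _
      have t2 := t1.rpow_const (p := (2 - (N : ℝ)) / 2) (Or.inl (by positivity))
      convert t2 using 2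
      · rfl
      rw [zero_pow two_ne_zero, zero_add, ← Real.rpow_natCast, ← Real.rpow_mul hy'.le]
      congr 1
      push_cast
      ring
  have hbub : Integrable (regPow N 1 (-(N + 2) / 2)) := by
    have := integrable_rpow_neg_one_add_norm_sq (E := EuclideanSpace ℝ (Fin N)) (μ := volume)
      (r := N + 2) (by simp)
    exact this
  have lim2 : Tendsto (fun n => ∫ y, regPow N 1 (-(N + 2) / 2) y * g (ε n • y)) atTop
      (𝓝 (∫ y, regPow N 1 (-(N + 2) / 2) y * g 0)) := by
    obtain ⟨hgc, C, hC, hb⟩ := d0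
    have hgb : ∀ x, ‖g x‖ ≤ C := fun x => (hb x).trans <| by
      have hw := one_le_of_exp_one_le (exp_one_le_weightW hA x)
      have : logProfile N 0 (weightW N A x) ≤ 1 := by
        rw [logProfile, Real.rpow_zero, mul_one]
        exact Real.rpow_le_one_of_one_le_of_nonpos hw (by linarith)
      nlinarith
    refine tendsto_integral_of_dominated_convergence (fun y => C * regPow N 1 (-(N + 2) / 2) y)
      (fun n => ((continuous_regPow one_pos _).mul
        (hgc.comp (continuous_const_smul _))).aestronglyMeasurable) (hbub.const_mul _)
      (fun n => Eventually.of_forall fun y => ?_) (Eventually.of_forall fun y => ?_)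
    · have := regPow_pos one_pos (-(N + 2) / 2) y
      rw [norm_mul, Real.norm_of_nonneg this.le, mul_comm]
      exact mul_le_mul_of_nonneg_right (hgb _) this.le
    · refine Tendsto.const_mul _ ((hgc.tendsto 0).comp ?_)
      simpa using hεt.smul_const y
  simp_rw [key] at lim1
  -- The constants cancel: the bubble has mass `σ_N / N`, multiplied by `N(N-2)` and by
  -- `1/((N-2)σ_N)`.
  have lim3 := ((lim2.const_mul ((N : ℝ) * (N - 2))).const_mul (fundConst N)).neg
  rw [tendsto_nhds_unique lim1 lim3, integral_mul_const, integral_bubble hN, fundConst]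
  have := sphereArea_pos hN
  have : (N : ℝ) - 2 ≠ 0 := by linarith
  field_simp

end Newton

/-! ### From a decay bound to a solution. -/

section Solution

open Set Topology

variable {N : ℕ} {A : ℝ}

lemma logPotential_eq (a τ : ℝ) : logPotential N A a τ = fun x =>
    ∫ y, fundSol N y • logProfile a τ (weightW N A (x - y)) := by
  ext x
  have := integral_sub_left_eq_self
    (fun y => fundSol N y • logProfile a τ (weightW N A (x - y))) volume x
  rw [← this]
  simp only [sub_sub_cancel, smul_eq_mul]
  rfl

lemma hasDecay_iteratedFDeriv_logProfile (hA : Real.exp 2 ≤ A) {τ : ℝ} (hτ : τ ≤ 0) (k : ℕ) :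
    HasDecay N A (iteratedFDeriv ℝ k fun y : EuclideanSpace ℝ (Fin N) =>
      logProfile N τ (weightW N A y)) := by
  obtain ⟨C, hC, h⟩ := norm_iteratedFDeriv_logProfile_weightW_le (N := N) hA N τ k
  exact ⟨(contDiff_logProfile_weightW hA N τ k).continuous_iteratedFDeriv le_rfl, C, hC,
    fun x => (h x).trans (mul_le_mul_of_nonneg_left
      (logProfile_le_logProfile_of_log_le (exp_one_le_weightW hA x) hτ) hC.le)⟩

lemma contDiff_logPotential (hA : Real.exp 2 ≤ A) (hN : 3 ≤ N) {τ : ℝ} (hτ : τ ≤ 0) (n : ℕ) :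
    ContDiff ℝ n (logPotential N A N τ) := by
  rw [logPotential_eq]
  exact contDiff_fundSol_convolution hA hN n (contDiff_logProfile_weightW hA N τ n)
    fun k _ => hasDecay_iteratedFDeriv_logProfile hA hτ k

/-- The Laplacian passes to the density, and the Newton identity at the origin is applied to the
translate `z ↦ v (x + z)`. The condition `τ ≤ 0` ensures that `v` and its derivatives are
`O(w^{-N})`. -/
theorem laplacian_logPotential (hA : Real.exp 2 ≤ A) (hN : 3 ≤ N) {τ : ℝ} (hτ : τ ≤ 0) :
    Δ (logPotential N A N τ) = fun x => -logProfile N τ (weightW N A x) := by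
  ext x
  set v := fun y : EuclideanSpace ℝ (Fin N) => logProfile N τ (weightW N A y) with hv
  have hc : ContDiff ℝ 2 v := contDiff_logProfile_weightW hA N τ 2
  have hd : ∀ k, HasDecay N A (iteratedFDeriv ℝ k v) := hasDecay_iteratedFDeriv_logProfile hA hτ
  rw [logPotential_eq, laplacian_fundSol_convolution hA hN hc (fun k _ => hd k) x]
  have hg : ContDiff ℝ 2 fun z => v (x + z) := hc.comp (contDiff_const.add contDiff_id)
  have h := integral_fundSol_mul_laplacian hA hN hg fun k _ => by
    rw [iteratedFDeriv_comp_add_left']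
    simpa only [sub_neg_eq_add] using ((hd k).comp_sub_left hA x).comp_neg
  rw [add_zero] at h
  rw [← integral_neg_eq_self, ← h]
  refine integral_congr_ae (Filter.Eventually.of_forall fun y => ?_)
  simp only [fundSol_neg, sub_neg_eq_add]
  rw [laplacian_eq_sum_fderiv, laplacian_eq_sum_fderiv]
  have e : (fderiv ℝ fun z => v (x + z)) = fun z => fderiv ℝ v (x + z) := by
    ext1 z
    rw [fderiv_comp_add_left]
  rw [e]
  simp only [fderiv_comp_add_left]

lemma abs_laplacian_logProfile_le (hA : Real.exp 2 ≤ A) (a b : ℝ) :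
    ∃ C > 0, ∀ x : EuclideanSpace ℝ (Fin N),
      |Δ (fun y => logProfile a b (weightW N A y)) x| ≤ C * logProfile a b (weightW N A x) := by
  obtain ⟨C, hC, h⟩ := norm_iteratedFDeriv_logProfile_weightW_le (N := N) hA a b 2
  refine ⟨(N + 1) * C, by positivity, fun x => ?_⟩
  have hp := logProfile_pos (a := a) (b := b) (exp_one_le_weightW hA x)
  rw [InnerProductSpace.laplacian_eq_iteratedFDeriv_orthonormalBasis _
    (EuclideanSpace.basisFun (Fin N) ℝ)]
  refine (Finset.abs_sum_le_sum_abs _ _).trans ?_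
  calc _ ≤ ∑ _i : Fin N, C * logProfile a b (weightW N A x) := by
        refine Finset.sum_le_sum fun i _ => le_trans ?_ (h x)
        refine (ContinuousMultilinearMap.le_opNorm (iteratedFDeriv ℝ 2
          (fun y : EuclideanSpace ℝ (Fin N) => logProfile a b (weightW N A y)) x) _).trans ?_
        simp [Fin.prod_univ_two]
    _ = N * (C * logProfile a b (weightW N A x)) := by simp
    _ ≤ _ := by
        have : 0 < C * logProfile a b (weightW N A x) := by positivity
        nlinarith

lemma logPotential_pos (hA : Real.exp 2 ≤ A) (hN : 3 ≤ N) {τ : ℝ} (hτ : -1 < τ)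
    (x : EuclideanSpace ℝ (Fin N)) : 0 < logPotential N A N τ x := by
  have : Nontrivial (EuclideanSpace ℝ (Fin N)) :=
    Module.nontrivial_of_finrank_pos (R := ℝ) (by simp; omega)
  obtain ⟨C, -, h⟩ := integrable_fundSol_sub_mul_logProfile hA hN hτ
  have hp := fun y : EuclideanSpace ℝ (Fin N) =>
    logProfile_pos (a := N) (b := τ) (exp_one_le_weightW hA y)
  have key := (integral_pos_iff_support_of_nonneg
    (fun y => mul_nonneg (fundSol_nonneg hN (x - y)) (hp y).le) (h x).1).2
  refine key (lt_of_lt_of_le (isOpen_compl_singleton.measure_pos volume (U := {x}ᶜ) ?_)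
    (measure_mono fun y hy => ?_))
  · obtain ⟨y, hy⟩ := exists_ne x
    exact ⟨y, hy⟩
  · have hxy : 0 < ‖x - y‖ := norm_pos_iff.2 (sub_ne_zero.2 (Ne.symm hy))
    have : 0 < fundSol N (x - y) := mul_pos (fundConst_pos hN) (Real.rpow_pos_of_pos hxy _)
    exact (mul_pos this (hp y)).ne'

lemma laplacian_const_mul {f : EuclideanSpace ℝ (Fin N) → ℝ} (hf : ContDiff ℝ 2 f) (c : ℝ) :
    Δ (fun x => c * f x) = fun x => c * Δ f x :=
  funext fun _ => InnerProductSpace.laplacian_smul c hf.contDiffAt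

/-- A decay bound for the nonlinear convolution yields a solution. -/
theorem exists_solution_of_convolution_decay (hA : Real.exp 2 ≤ A) (hN : 3 ≤ N)
    {α β p q T c d : ℝ} (hp : 0 < p) (hq : 0 < q) (hpq : 1 < p + q) (hT0 : 0 < T) (hT1 : T < 1)
    (hconv : ∃ C > 0, ∀ x : EuclideanSpace ℝ (Fin N), ∫⁻ y, ENNReal.ofReal
      (kernelK N α β (x - y) * logProfile ((N - 2) * p) (T * p) (weightW N A y)) ≤
      ENNReal.ofReal (C * logProfile c d (weightW N A x)))
    (hdecay : N < c + (N - 2) * q ∨ N = c + (N - 2) * q ∧ d + T * q ≤ T - 1) :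
    ∃ lam : ℝ, 0 < lam ∧ ∃ C : ℝ, 0 < C ∧
      IsNonnegSolution N α β p q lam (fun x => C * logPotential N A N (T - 1) x) := by
  obtain ⟨M1, hM1, hconv⟩ := hconv
  obtain ⟨M0, hM0, hpot⟩ := integrable_fundSol_sub_mul_logProfile hA hN (b := T - 1) (by linarith)
  obtain ⟨M2, hM2, hlex⟩ := logProfile_le_of_lex (a := c + (N - 2) * q) (b := d + T * q)
    (c := N) (d := T - 1) hdecay
  obtain ⟨M3, hM3, hlap⟩ := abs_laplacian_logProfile_le (N := N) hA N (T - 1)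
  have hu0 := logPotential_pos hA hN (by linarith : -1 < T - 1)
  set u₀ := logPotential N A N (T - 1) with hu₀
  set φ : ℝ → ℝ → EuclideanSpace ℝ (Fin N) → ℝ := fun a b x => logProfile a b (weightW N A x)
    with hφ
  have hφp : ∀ a b x, 0 < φ a b x := fun a b x => logProfile_pos (exp_one_le_weightW hA x)
  have hule : ∀ x, u₀ x ≤ M0 * φ (N - 2) T x := fun x => by
    have := (hpot x).2
    rwa [sub_add_cancel] at this
  have hpow : ∀ {r : ℝ}, 0 < r → ∀ x, u₀ x ^ r ≤ M0 ^ r * φ ((N - 2) * r) (T * r) x :=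
    fun {r} hr x => by
      refine (Real.rpow_le_rpow (hu0 x).le (hule x) hr.le).trans_eq ?_
      rw [Real.mul_rpow hM0.le (hφp _ _ x).le]
      congr 1
      exact logProfile_rpow (exp_one_le_weightW hA x) r
  have hcu : ContDiff ℝ 4 u₀ := contDiff_logPotential hA hN (by linarith : T - 1 ≤ 0) 4
  have hmu : Measurable u₀ := hcu.continuous.measurable
  have hKm : ∀ x, AEStronglyMeasurable (fun y => kernelK N α β (x - y) * u₀ y ^ p) := fun x =>
    (((measurable_kernelK α β).comp (measurable_const.sub measurable_id)).mul
      (hmu.pow_const p)).aestronglyMeasurable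
  have hKn : ∀ x y, 0 ≤ kernelK N α β (x - y) * u₀ y ^ p := fun x y =>
    mul_nonneg (kernelK_nonneg _ _ _) (Real.rpow_nonneg (hu0 y).le _)
  have hKle : ∀ x, ∫⁻ y, ENNReal.ofReal (kernelK N α β (x - y) * u₀ y ^ p) ≤
      ENNReal.ofReal (M0 ^ p * (M1 * φ c d x)) := fun x => by
    rw [ENNReal.ofReal_mul (by positivity)]
    refine le_trans ?_ (mul_le_mul_right (hconv x) _)
    rw [← lintegral_const_mul' _ _ ENNReal.ofReal_ne_top]
    refine lintegral_mono fun y => ?_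
    rw [← ENNReal.ofReal_mul (by positivity)]
    refine ENNReal.ofReal_le_ofReal ?_
    calc _ ≤ kernelK N α β (x - y) * (M0 ^ p * φ ((N - 2) * p) (T * p) y) :=
          mul_le_mul_of_nonneg_left (hpow hp y) (kernelK_nonneg _ _ _)
      _ = _ := by ring
  have hKi : ∀ x, Integrable fun y => kernelK N α β (x - y) * u₀ y ^ p := fun x =>
    ⟨hKm x, (hasFiniteIntegral_iff_ofReal (Filter.Eventually.of_forall (hKn x))).2
      ((hKle x).trans_lt ENNReal.ofReal_lt_top)⟩
  have hKint : ∀ x, convK N α β p u₀ x ≤ M0 ^ p * (M1 * φ c d x) := fun x => by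
    have := hφp c d x
    rw [convK, integral_eq_lintegral_of_nonneg_ae (Filter.Eventually.of_forall (hKn x)) (hKm x)]
    exact ENNReal.toReal_le_of_le_ofReal (by positivity) (hKle x)
  set M := M0 ^ p * M1 * M0 ^ q * M2 with hM
  have hMpos : 0 < M := by positivity
  have hmain : ∀ x, convK N α β p u₀ x * u₀ x ^ q ≤ M * φ N (T - 1) x := fun x => by
    have p1 := hφp c d x
    have hmul : φ c d x * φ ((N - 2) * q) (T * q) x = φ (c + (N - 2) * q) (d + T * q) x :=
      logProfile_mul (exp_one_le_weightW hA x)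
    calc _ ≤ (M0 ^ p * (M1 * φ c d x)) * (M0 ^ q * φ ((N - 2) * q) (T * q) x) :=
          mul_le_mul (hKint x) (hpow hq x) (Real.rpow_nonneg (hu0 x).le _) (by positivity)
      _ = (M0 ^ p * M1 * M0 ^ q) * (φ c d x * φ ((N - 2) * q) (T * q) x) := by ring
      _ ≤ (M0 ^ p * M1 * M0 ^ q) * (M2 * φ N (T - 1) x) := by
          rw [hmul]
          exact mul_le_mul_of_nonneg_left (hlex _ (exp_one_le_weightW hA x)) (by positivity)
      _ = _ := by rw [hM]; ring
  have hs : 0 < p + q - 1 := by linarith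
  -- Chosen so that `C^{p+q} M = C`: after scaling, the nonlinear term is at most `C v`.
  set C := M⁻¹ ^ (1 / (p + q - 1)) with hC
  have hCpos : 0 < C := by positivity
  have hCM : C ^ p * C ^ q * M = C := by
    have e1 : C ^ (p + q - 1) = M⁻¹ := by
      rw [hC, ← Real.rpow_mul (by positivity), one_div_mul_cancel hs.ne', Real.rpow_one]
    rw [← Real.rpow_add hCpos, show p + q = (p + q - 1) + 1 by ring, Real.rpow_add_one hCpos.ne',
      e1]
    field_simp
  have hmulpow : ∀ {r : ℝ} (x : EuclideanSpace ℝ (Fin N)), (C * u₀ x) ^ r = C ^ r * u₀ x ^ r :=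
    fun x => Real.mul_rpow hCpos.le (hu0 x).le
  have hcomm : ∀ x y, kernelK N α β (x - y) * (C * u₀ y) ^ p =
      C ^ p * (kernelK N α β (x - y) * u₀ y ^ p) := fun x y => by rw [hmulpow]; ring
  -- With `λ = M3 + 1`, the part `M3` compensates `-Δv ≥ -M3 v`, and the remaining unit leaves `C v`
  -- to dominate the nonlinearity.
  refine ⟨M3 + 1, by positivity, C, hCpos, ⟨contDiff_const.mul hcu,
    fun x => (mul_pos hCpos (hu0 x)).le, fun x => ?_, fun x => ?_⟩⟩
  · simp_rw [hcomm]
    exact (hKi x).const_mul _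
  · have hv := hφp N (T - 1) x
    have hvc : ContDiff ℝ 2 (φ N (T - 1)) := contDiff_logProfile_weightW hA _ _ 2
    have hL1 : Δ (fun x => C * u₀ x) = fun x => -C * φ N (T - 1) x := by
      rw [laplacian_const_mul (hcu.of_le (by norm_num)),
        laplacian_logPotential hA hN (by linarith : T - 1 ≤ 0)]
      ext x
      ring
    rw [hL1, laplacian_const_mul hvc]
    have hconvC : convK N α β p (fun x => C * u₀ x) x = C ^ p * convK N α β p u₀ x := by
      simp_rw [convK, hcomm]
      rw [integral_const_mul]
    have hl := le_of_abs_le (hlap x)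
    calc _ = C ^ p * C ^ q * (convK N α β p u₀ x * u₀ x ^ q) := by
          rw [hconvC, hmulpow]; ring
      _ ≤ C ^ p * C ^ q * (M * φ N (T - 1) x) :=
          mul_le_mul_of_nonneg_left (hmain x) (by positivity)
      _ = C * φ N (T - 1) x := by rw [← mul_assoc, hCM]
      _ ≤ _ := by
          have := mul_le_mul_of_nonneg_left hl hCpos.le
          simp only [hφ] at *
          nlinarith

end Solution

/-! ### Choice of the exponents in the six cases. -/

theorem theorem3 (N : ℕ) (hN : 3 ≤ N) (α β p q : ℝ)
    (hα0 : 0 ≤ α) (hαN : α < N) (hβ : α - N < β) (hp : 0 < p) (hq : 0 < q)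
    (hcase :
      (((N : ℝ) - α) / ((N : ℝ) - 2) < p ∧ ((N : ℝ) - α) / ((N : ℝ) - 2) < q ∧
        (2 * (N : ℝ) - α) / ((N : ℝ) - 2) < p + q) ∨
      (p = ((N : ℝ) - α) / ((N : ℝ) - 2) ∧ (N : ℝ) / ((N : ℝ) - 2) < q ∧ β < -1) ∨
      ((N : ℝ) / ((N : ℝ) - 2) < p ∧ q = ((N : ℝ) - α) / ((N : ℝ) - 2) ∧ β < -1) ∨
      (((N : ℝ) - α) / ((N : ℝ) - 2) < p ∧ ((N : ℝ) - α) / ((N : ℝ) - 2) < q ∧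
        p + q = (2 * (N : ℝ) - α) / ((N : ℝ) - 2) ∧ β < -1) ∨
      (p = ((N : ℝ) - α) / ((N : ℝ) - 2) ∧ q = (N : ℝ) / ((N : ℝ) - 2) ∧ β < -2) ∨
      (p = (N : ℝ) / ((N : ℝ) - 2) ∧ q = ((N : ℝ) - α) / ((N : ℝ) - 2) ∧ β < -2)) :
    ∃ lam : ℝ, 0 < lam ∧ ∃ u : EuclideanSpace ℝ (Fin N) → ℝ,
      IsNonnegSolution N α β p q lam u ∧
      (∀ x, 0 < u x) ∧
      ∃ A γ τ C : ℝ, Real.exp 1 < A ∧ 2 < γ ∧ γ ≤ N ∧ -1 < τ ∧ τ < 1 ∧ 0 < C ∧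
        ∀ x, u x = C * logPotential N A γ τ x := by
  have hN' : (3 : ℝ) ≤ N := by exact_mod_cast hN
  have hm : (0 : ℝ) < N - 2 := by linarith
  have hA : Real.exp 2 ≤ Real.exp 2 := le_rfl
  suffices H : ∃ T c d : ℝ, 0 < T ∧ T < 1 ∧ 1 < p + q ∧
      ((N < (N - 2) * p ∧ c = α ∧ d = β) ∨
      (N - α < (N - 2) * p ∧ (N - 2) * p < N ∧ c = α + (N - 2) * p - N ∧ d = β + T * p) ∨
      ((N - 2) * p = N ∧ -1 < T * p ∧ (0 < α ∨ β + T * p < -1) ∧ c = α ∧ d = β + T * p + 1) ∨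
      ((N - 2) * p = N - α ∧ -1 < T * p ∧ β + T * p < -1 ∧ c = 0 ∧ d = β + T * p + 1)) ∧
      ((N : ℝ) < c + (N - 2) * q ∨ N = c + (N - 2) * q ∧ d + T * q ≤ T - 1) by
    obtain ⟨T, c, d, hT0, hT1, hpq, hreg, hdec⟩ := H
    obtain ⟨lam, hlam, C, hC, hsol⟩ := exists_solution_of_convolution_decay hA hN hp hq hpq hT0 hT1
      (kernelK_convolution_decay hA (by omega) hα0 hαN hβ hreg) hdec
    exact ⟨lam, hlam, _, hsol,
      fun x => mul_pos hC (logPotential_pos hA hN (by linarith) x),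
      Real.exp 2, N, T - 1, C, Real.exp_lt_exp.2 (by norm_num), by linarith, le_rfl, by linarith,
      by linarith, hC, fun x => rfl⟩
  -- All logarithmic losses are bounded by `T(p+q)`, so `T` is tuned to the slack `δ` that `β`
  -- leaves.
  have small : ∀ δ : ℝ, 0 < δ → ∃ T : ℝ, 0 < T ∧ T < 1 ∧ T * p + T * q < δ := fun δ hδ => by
    refine ⟨min (1 / 2) (δ / (2 * (p + q))), by positivity,
      (min_le_left _ _).trans_lt (by norm_num), ?_⟩
    have h1 := min_le_right (1 / 2) (δ / (2 * (p + q)))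
    rw [← mul_add]
    calc _ ≤ δ / (2 * (p + q)) * (p + q) := by gcongr
      _ = δ / 2 := by field_simp
      _ < δ := by linarith
  have hsum : 2 * (N : ℝ) - α ≤ (N - 2) * (p + q) → 1 < p + q := fun h => by
    by_contra hcon
    nlinarith
  rcases hcase with ⟨h1, h2, h3⟩ | ⟨h1, h2, h3⟩ | ⟨h1, h2, h3⟩ | ⟨h1, h2, h3, h4⟩ |
    ⟨h1, h2, h3⟩ | ⟨h1, h2, h3⟩
  -- Case (i): the power decay is strict in each regime of `p`, so `T` only has to be admissible.
  -- When `(N-2)p = N`, the strict lower bound on `p` forces `α > 0`.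
  · rw [div_lt_iff₀' hm] at h1 h2 h3
    obtain ⟨T, hT0, hT1, hT⟩ := small 1 one_pos
    have hTp : 0 < T * p := mul_pos hT0 hp
    rcases lt_trichotomy ((N - 2) * p) N with h | h | h
    · exact ⟨T, _, _, hT0, hT1, hsum h3.le, Or.inr (Or.inl ⟨h1, h, rfl, rfl⟩),
        Or.inl (by linarith)⟩
    · exact ⟨T, _, _, hT0, hT1, hsum h3.le, Or.inr (Or.inr (Or.inl
        ⟨h, by linarith, Or.inl (by linarith), rfl, rfl⟩)), Or.inl (by linarith)⟩
    · exact ⟨T, _, _, hT0, hT1, hsum h3.le, Or.inl ⟨h, rfl, rfl⟩, Or.inl (by linarith)⟩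
  · rw [div_lt_iff₀' hm] at h2
    rw [eq_div_iff hm.ne', mul_comm] at h1
    obtain ⟨T, hT0, hT1, hT⟩ := small (-1 - β) (by linarith)
    have hTp : 0 < T * p := mul_pos hT0 hp
    have hTq : 0 < T * q := mul_pos hT0 hq
    exact ⟨T, _, _, hT0, hT1, hsum (by linarith), Or.inr (Or.inr (Or.inr
      ⟨h1, by linarith, by linarith, rfl, rfl⟩)), Or.inl (by linarith)⟩
  -- Case (iii): `c = α` gives equality of powers, and the slack `-1 - β` pays for `Tq`.
  · rw [div_lt_iff₀' hm] at h1
    rw [eq_div_iff hm.ne', mul_comm] at h2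
    obtain ⟨T, hT0, hT1, hT⟩ := small (-1 - β) (by linarith)
    have hTp : 0 < T * p := mul_pos hT0 hp
    exact ⟨T, _, _, hT0, hT1, hsum (by linarith), Or.inl ⟨h1, rfl, rfl⟩,
      Or.inr ⟨by linarith, by linarith⟩⟩
  -- Case (iv): the sum condition and the lower bound on `q` force `(N-2)p < N`, hence the second
  -- regime, with equality of powers.
  · rw [div_lt_iff₀' hm] at h1 h2
    rw [eq_div_iff hm.ne', mul_comm] at h3
    obtain ⟨T, hT0, hT1, hT⟩ := small (-1 - β) (by linarith)
    exact ⟨T, _, _, hT0, hT1, hsum h3.ge, Or.inr (Or.inl ⟨h1, by linarith, rfl, rfl⟩),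
      Or.inr ⟨by linarith, by linarith⟩⟩
  -- Cases (v) and (vi): the convolution already gains a logarithm and the powers are equal, so one
  -- more unit is asked of `β`. In (vi) the bound on `β` also covers `α = 0`.
  · rw [eq_div_iff hm.ne', mul_comm] at h1 h2
    obtain ⟨T, hT0, hT1, hT⟩ := small (-2 - β) (by linarith)
    have hTp : 0 < T * p := mul_pos hT0 hp
    have hTq : 0 < T * q := mul_pos hT0 hq
    exact ⟨T, _, _, hT0, hT1, hsum (by linarith), Or.inr (Or.inr (Or.inr
      ⟨h1, by linarith, by linarith, rfl, rfl⟩)), Or.inr ⟨by linarith, by linarith⟩⟩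
  · rw [eq_div_iff hm.ne', mul_comm] at h1 h2
    obtain ⟨T, hT0, hT1, hT⟩ := small (-2 - β) (by linarith)
    have hTp : 0 < T * p := mul_pos hT0 hp
    have hTq : 0 < T * q := mul_pos hT0 hq
    exact ⟨T, _, _, hT0, hT1, hsum (by linarith), Or.inr (Or.inr (Or.inl
      ⟨h1, by linarith, Or.inr (by linarith), rfl, rfl⟩)), Or.inr ⟨by linarith, by linarith⟩⟩
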